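/- **Setting.** Let $W=\{(x,y): 1\le x\le X,\ 1\le y\le Y\}$ be a grid with a set $W_{free}\subseteq W$ of obstacle-free cells that is strongly connected (any free cell can be reached from any other through side-adjacent free cells); $X,Y$ are known and $W_{free}$ is not. There are $R\ge 1$ failure-free robots, starting in pairwise different free cells. The state of a robot is its location together with an orientation from a finite set. All robots share a finite set $M$ of motion primitives with real costs, whose effect (displacement and new orientation) depends on the orientation only. $M$ contains $\mathtt{Halt}$, which keeps the state; every primitive leads to the same or a side-adjacent cell; and from every orientation a robot can, after turning within its cell if necessary, move to each of the four side-adjacent cells (as a quadcopter or a TurtleBot can). A path is a start state with a sequence of primitives. **Views.** A view consists of disjoint sets of covered, goal and obstacle cells; the other grid cells are unexplored. In each state it visits, a robot marks its cell as covered in its local view, and marks each unexplored side-neighbour in the grid as a goal if that cell is free and holds no other robot, and as an obstacle otherwise. The global view, initially all unexplored, is updated by a received local view $L$: the covered cells of $L$ become covered; the goals (obstacles) of $L$ that were unexplored become goals (obstacles); covered cells are removed from the goals and obstacles. $W_c$ and $W_g$ denote the covered cells and goals of the global view. **The planner $\mathtt{OnDemCPP}$** runs in horizons. Communication is reliable.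 Initially all robots send their states and local views; in each later horizon the robots that were active in the previous one do so. Requests are received one by one in any order. The *participants* are the robots without remaining path; $\widetilde W_g$ is the set of end cells of the remaining paths. When all requests have been received: 1. If $W_g\setminus\widetilde W_g=\emptyset$ and all robots are participants, the planner exits. If $W_g\setminus\widetilde W_g=\emptyset$ and some robot is not a participant, all participants get zero-length paths. Otherwise their paths are computed by steps 2 to 5. 2. Participants are assigned to distinct goals of $W_g\setminus\widetilde W_g$ that they can reach through $W_g\cup W_c$, as many as possible and then with least total cost. An assigned participant (active) gets a cheapest cycle-free path to its goal through $W_g\cup W_c$, ending on its first visit to the goal; any other participant (inactive) gets the zero-length path. 3. *Feasibility.* Two participants form an infeasible pair if an inactive one sits on the path of an active one, or both are active and their starts are on each other's path, or both are active and the start and goal of one are on the path of the other. The active participants that form an infeasible pair with an inactive or active participant, or whose path contains the start of an already killed one, are killed, until there are no more; their assignments are cancelled. Then the old path of each killed participant $i$ is processed once, in any order of the killed participants, from its end backwards until the start of a currently unassigned participant $j$ is met (if any); $j$ then gets $i$'s goal, with a path that follows the cells of the rest of $i$'s path, provided that this creates no infeasible pair containing $j$. 4. *Precedence.* Participant $i$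 must move before $j\neq i$ if the start of $i$ is on $j$'s path or the goal of $j$ is on $i$'s path. If these precedences contain a cycle, the robots are arranged linearly so that at least half of the precedence pairs point forward, the participants at the tails (or those at the heads) of all backward pairs are inactivated, and the planner returns to step 3. 5. *Offsets.* Otherwise, in an order that respects the precedences, each active participant waits at its start for the least time for which it never collides (same cell or head-on) with a non-participant following its remaining path or with a participant treated before, where every robot stays at the end of its path; if there is no such time, it is inactivated. If some participant was inactivated, the planner returns to step 3. 6. Participants take their new paths (waiting included) and non-participants keep their remaining paths. The robots with paths of non-zero length are active. The horizon length $\lambda$ is the least length of an active robot's path. The active robots synchronously follow the first $\lambda$ steps of their paths, updating their local views at each step; the rests are their remaining paths. Inactive robots stay for $\lambda$ steps. The next horizon begins. (If no robot is active, the planner waits forever.) **Theorem.** Whatever choices are made among ties and orders, $\mathtt{OnDemCPP}$ terminates: no run is infinite (in particular each loop over steps 3 to 5 ends), and no run gets stuck before the planner exits. When the planner exits, coverage is complete: the full paths of all robots have the same length, and the set of all cells that the robots have visited is exactly $W_{free}$. -/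

import Mathlib

noncomputable section

namespace OnDemCPP

/-! ### Workspace -/

/-- A grid cell `(x, y)`. -/
abbrev Cell := ℤ × ℤ

/-- The `X × Y` grid: all `(x, y)` with `1 ≤ x ≤ X` and `1 ≤ y ≤ Y`. -/
def grid (X Y : ℕ) : Finset Cell := Finset.Icc (1 : ℤ) X ×ˢ Finset.Icc (1 : ℤ) Y

/-- The displacements to the four side-neighbours of a cell (east, west, north, south). -/
def dirs : Finset Cell := {(1, 0), (-1, 0), (0, 1), (0, -1)}

/-- The four side-neighbours of a cell. -/
def nbrs (p : Cell) : Finset Cell := dirs.image (fun d => p + d)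

/-- Any cell of `free` can be reached from any other one through side-adjacent cells of `free`. -/
def StronglyConnected (free : Finset Cell) : Prop :=
  ∀ a ∈ free, ∀ b ∈ free,
    Relation.ReflTransGen (fun p q => q ∈ nbrs p ∧ q ∈ free) a b

/-! ### Robots, motion primitives and paths -/

/-- The state of a robot: its location, and its orientation in a type `Θ`
(a one-point type if the robot has no orientation). -/
abbrev State (Θ : Type*) := Cell × Θ

/-- A set `M` of motion primitives, common to all robots. Primitive `μ`, applied in a state with
orientation `θ`, moves the robot by `disp μ θ` and gives it the orientation `turn μ θ`. -/
structure Motion (Θ M : Type*) where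
  /-- the primitive that keeps the state unchanged -/
  halt : M
  turn : M → Θ → Θ
  disp : M → Θ → Cell
  cost : M → ℝ

/-- What is understood about the motion primitives of a ground robot or quadcopter: `halt` keeps
the state, a primitive leads to the same cell or to one of the four neighbouring cells, and from
every orientation the robot can, after turning in its cell if necessary, move to each of the four
neighbouring cells. -/
structure Motion.Admissible {Θ M : Type*} (m : Motion Θ M) : Prop where
  halt_turn : ∀ θ, m.turn m.halt θ = θ
  halt_disp : ∀ θ, m.disp m.halt θ = 0
  disp_mem : ∀ μ θ, m.disp μ θ = 0 ∨ m.disp μ θ ∈ dirs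
  mobile : ∀ θ, ∀ d ∈ dirs, ∃ θ',
    Relation.ReflTransGen (fun a b => ∃ μ, m.disp μ a = 0 ∧ m.turn μ a = b) θ θ' ∧
      ∃ μ, m.disp μ θ' = d

section Paths

variable {Θ M : Type*} (m : Motion Θ M)

/-- The state after applying one primitive. -/
def Motion.next (s : State Θ) (μ : M) : State Θ := (s.1 + m.disp μ s.2, m.turn μ s.2)

/-- A path is given by its first state `s` and its sequence of primitives `p`; its length is
`p.length`. This is the sequence of its `p.length + 1` states. -/
def Motion.states (s : State Θ) (p : List M) : List (State Θ) := p.scanl m.next s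

/-- The last state of a path. -/
def Motion.final (s : State Θ) (p : List M) : State Θ := p.foldl m.next s

/-- The sequence of the locations along a path. -/
def Motion.cells (s : State Θ) (p : List M) : List Cell := (m.states s p).map Prod.fst

/-- The location at time `t` of a robot that follows a path and then stays at its end. -/
def Motion.pos (s : State Θ) (p : List M) (t : ℕ) : Cell := (m.final s (p.take t)).1

/-- The cost of a path. -/
def Motion.pathCost (p : List M) : ℝ := (p.map m.cost).sum

/-- Two robots that follow these paths collide at some time, in the same cell or head-on. -/
def Motion.Collide (s : State Θ) (p : List M) (s' : State Θ) (p' : List M) : Prop :=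
  ∃ t, m.pos s p t = m.pos s' p' t ∨
    (m.pos s p t = m.pos s' p' (t + 1) ∧ m.pos s p (t + 1) = m.pos s' p' t)

/-- A cycle-free path in the state transition graph over the cells in `region`, from the state `s`
to a state located at `γ`, that ends as soon as it is located at `γ`. -/
def Motion.IsRoute (region : Finset Cell) (s : State Θ) (γ : Cell) (p : List M) : Prop :=
  (m.states s p).Nodup ∧ (∀ c ∈ m.cells s p, c ∈ region) ∧
    (m.final s p).1 = γ ∧ ∀ t < p.length, m.pos s p t ≠ γ

/-- A cheapest such path. -/
def Motion.IsOptRoute (region : Finset Cell) (s : State Θ) (γ : Cell) (p : List M) : Prop :=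
  m.IsRoute region s γ p ∧ ∀ p', m.IsRoute region s γ p' → m.pathCost p ≤ m.pathCost p'

end Paths

/-! ### Local and global views -/

/-- A view of the workspace: its covered, goal and obstacle cells. The remaining cells of the grid
are the unexplored ones. -/
structure View where
  cov : Finset Cell
  goal : Finset Cell
  obs : Finset Cell

/-- The view in which every cell is unexplored. -/
def View.empty : View := ⟨∅, ∅, ∅⟩

/-- The unexplored cells of a view. -/
def View.unexplored (X Y : ℕ) (V : View) : Finset Cell := grid X Y \ (V.cov ∪ V.goal ∪ V.obs)

/-- A robot located at `p` updates its local view: `p` is covered, and each neighbouring cell that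
is unexplored so far becomes a goal or an obstacle, as read by the rangefinder. The rangefinder
cannot distinguish an obstacle from another robot; `occ` is the set of cells that hold other
robots. -/
def View.observe (X Y : ℕ) (free occ : Finset Cell) (V : View) (p : Cell) : View :=
  let seen := nbrs p ∩ V.unexplored X Y
  let cov := insert p V.cov
  { cov := cov
    goal := (V.goal ∪ seen ∩ (free \ occ)) \ cov
    obs := (V.obs ∪ seen \ (free \ occ)) \ cov }

/-- The update of the global view `V` with a received local view `L`. -/
def View.merge (X Y : ℕ) (V L : View) : View :=
  let cov := V.cov ∪ L.cov
  { cov := cov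
    goal := (V.goal ∪ L.goal ∩ V.unexplored X Y) \ cov
    obs := (V.obs ∪ L.obs ∩ V.unexplored X Y) \ cov }

/-! ### Planning for the participants

`st i` is the current state of robot `i`, `I` is the set of participants, `Γ i` is the goal assigned
to robot `i` (`none` if robot `i` is inactive), `Φ i` and `Ω i` are sequences of primitives, to be
applied from `st i` on; the empty sequence is the path that contains only the state `st i`. -/

section Planning

variable {R : ℕ} {Θ M : Type*} (m : Motion Θ M) (st : Fin R → State Θ) (I : Finset (Fin R))

/-- `Γ` assigns to participants distinct goals from `targets`, each reachable through `region`. -/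
def IsAssignment (targets region : Finset Cell) (Γ : Fin R → Option Cell) : Prop :=
  (∀ i γ, Γ i = some γ → i ∈ I ∧ γ ∈ targets ∧ ∃ p, m.IsRoute region (st i) γ p) ∧
    ∀ i j γ, Γ i = some γ → Γ j = some γ → i = j

/-- The number of assigned robots. -/
def numAssigned (Γ : Fin R → Option Cell) : ℕ :=
  (Finset.univ.filter fun i => (Γ i).isSome = true).card

/-- The total cost of an assignment, for the matrix of paths `L`. -/
def assignCost (L : Fin R → Cell → List M) (Γ : Fin R → Option Cell) : ℝ :=
  ∑ i, (Γ i).elim 0 fun γ => m.pathCost (L i γ)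

/-- Cost-optimal goal assignment and corresponding paths: `L` holds an optimal path for each pair of
a participant and a goal in `targets` that it can reach, `Γ` is a cheapest assignment of the largest
possible number of participants, and `Φ` are the corresponding paths. -/
def OptimalPaths (targets region : Finset Cell)
    (Γ : Fin R → Option Cell) (Φ : Fin R → List M) : Prop :=
  ∃ L : Fin R → Cell → List M,
    (∀ i ∈ I, ∀ γ ∈ targets, (∃ p, m.IsRoute region (st i) γ p) →
      m.IsOptRoute region (st i) γ (L i γ)) ∧
    IsAssignment m st I targets region Γ ∧
    (∀ Γ', IsAssignment m st I targets region Γ' →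
      numAssigned Γ' ≤ numAssigned Γ ∧
        (numAssigned Γ' = numAssigned Γ → assignCost m L Γ ≤ assignCost m L Γ')) ∧
    ∀ i, Φ i = (Γ i).elim [] (L i)

/-- The start location of robot `i` is on the path of robot `j`. -/
def StartOn (Φ : Fin R → List M) (i j : Fin R) : Prop := (st i).1 ∈ m.cells (st j) (Φ j)

/-- The goal location of robot `i` is on the path of robot `j`. -/
def GoalOn (Γ : Fin R → Option Cell) (Φ : Fin R → List M) (i j : Fin R) : Prop :=
  ∃ γ, Γ i = some γ ∧ γ ∈ m.cells (st j) (Φ j)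

/-- One of the robots is inactive and sits on the path of the other, active one, or both are active
and their start locations are on each other's path. -/
def Crossover (Γ : Fin R → Option Cell) (Φ : Fin R → List M) (i j : Fin R) : Prop :=
  (Γ i = none ∧ Γ j ≠ none ∧ StartOn m st Φ i j) ∨
  (Γ j = none ∧ Γ i ≠ none ∧ StartOn m st Φ j i) ∨
  (Γ i ≠ none ∧ Γ j ≠ none ∧ StartOn m st Φ i j ∧ StartOn m st Φ j i)

/-- Both robots are active, and the start and goal of one of them are on the path of the other. -/
def Nested (Γ : Fin R → Option Cell) (Φ : Fin R → List M) (i j : Fin R) : Prop :=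
  Γ i ≠ none ∧ Γ j ≠ none ∧
    ((StartOn m st Φ i j ∧ GoalOn m st Γ Φ i j) ∨ (StartOn m st Φ j i ∧ GoalOn m st Γ Φ j i))

/-- The paths of the two robots form an infeasible pair. -/
def Infeasible (Γ : Fin R → Option Cell) (Φ : Fin R → List M) (i j : Fin R) : Prop :=
  Crossover m st Γ Φ i j ∨ Nested m st Γ Φ i j

/-- The active participants that get killed: those that form an infeasible pair with an inactive or
active participant, or with an already killed one, which from then on sits at its start. -/
inductive Killed (Γ : Fin R → Option Cell) (Φ : Fin R → List M) : Fin R → Prop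
  | pair (i j : Fin R) : i ∈ I → j ∈ I → i ≠ j → Γ i ≠ none → Infeasible m st Γ Φ i j →
      Killed Γ Φ i
  | blocked (i j : Fin R) : i ∈ I → i ≠ j → Γ i ≠ none → Killed Γ Φ j → StartOn m st Φ j i →
      Killed Γ Φ i

/-- When the path `p` of the killed participant `i` (with goal `γ`) is processed in reverse, the
unrevived participant `j` is the first one found, and `w` is a path for `j` to `γ` generated from
`p`: from the state of `j` on, it follows the cells of `p` after the location of `j`
(turning or waiting within a cell is not prescribed). The participants that are unrevived are those
that have no goal in the current assignment `Γ'`. -/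
def Candidate (Γ' : Fin R → Option Cell) (i : Fin R) (p : List M) (j : Fin R) (w : List M) : Prop :=
  j ∈ I ∧ Γ' j = none ∧
    ∃ pre suf : List Cell, m.cells (st i) p = pre ++ (st j).1 :: suf ∧
      (∀ k ∈ I, Γ' k = none → (st k).1 ∉ suf) ∧
      (m.cells (st j) w).destutter (· ≠ ·) = ((st j).1 :: suf).destutter (· ≠ ·)

/-- Participant `j` forms no infeasible pair with any other participant. -/
def NoConflict (Γ : Fin R → Option Cell) (Φ : Fin R → List M) (j : Fin R) : Prop :=
  ∀ k ∈ I, k ≠ j → ¬ Infeasible m st Γ Φ j k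

/-- Processing the paths of the killed participants, in the order of a list, transforms the current
assignment and paths into new ones. -/
inductive Revive (Γ : Fin R → Option Cell) (Φ : Fin R → List M) :
    List (Fin R) → (Fin R → Option Cell) → (Fin R → List M) →
      (Fin R → Option Cell) → (Fin R → List M) → Prop
  | nil (Γ₁ Ω₁) : Revive Γ Φ [] Γ₁ Ω₁ Γ₁ Ω₁
  /-- no unrevived participant is found on the path of `i` -/
  | skip (i ks Γ₁ Ω₁ Γ₂ Ω₂) :
      (∀ k ∈ I, Γ₁ k = none → (st k).1 ∉ m.cells (st i) (Φ i)) →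
      Revive Γ Φ ks Γ₁ Ω₁ Γ₂ Ω₂ → Revive Γ Φ (i :: ks) Γ₁ Ω₁ Γ₂ Ω₂
  /-- participant `j` is found and gets revived -/
  | revive (i ks Γ₁ Ω₁ Γ₂ Ω₂ j w) :
      Candidate m st I Γ₁ i (Φ i) j w →
      NoConflict m st I (Function.update Γ₁ j (Γ i)) (Function.update Ω₁ j w) j →
      Revive Γ Φ ks (Function.update Γ₁ j (Γ i)) (Function.update Ω₁ j w) Γ₂ Ω₂ →
      Revive Γ Φ (i :: ks) Γ₁ Ω₁ Γ₂ Ω₂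
  /-- participant `j` is found but would form an infeasible pair -/
  | fail (i ks Γ₁ Ω₁ Γ₂ Ω₂ j w) :
      Candidate m st I Γ₁ i (Φ i) j w →
      ¬ NoConflict m st I (Function.update Γ₁ j (Γ i)) (Function.update Ω₁ j w) j →
      Revive Γ Φ ks Γ₁ Ω₁ Γ₂ Ω₂ → Revive Γ Φ (i :: ks) Γ₁ Ω₁ Γ₂ Ω₂

open Classical in
/-- Goal reassignment: kill, then revive. `Γ'` and `Ω` are the resulting assignment and paths. -/
def FeasiblePaths (Γ : Fin R → Option Cell) (Φ : Fin R → List M)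
    (Γ' : Fin R → Option Cell) (Ω : Fin R → List M) : Prop :=
  ∃ ks : List (Fin R), ks.Nodup ∧ (∀ i, i ∈ ks ↔ Killed m st I Γ Φ i) ∧
    Revive m st I Γ Φ ks
      (fun i => if Killed m st I Γ Φ i then none else Γ i)
      (fun i => if Killed m st I Γ Φ i then [] else Φ i) Γ' Ω

/-- Relative precedence of participants: `i` must move before `j`. -/
def Precedes (Γ : Fin R → Option Cell) (Ω : Fin R → List M) (i j : Fin R) : Prop :=
  i ∈ I ∧ j ∈ I ∧ i ≠ j ∧ (StartOn m st Ω i j ∨ GoalOn m st Γ Ω j i)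

/-- An absolute precedence: an ordering of the participants, each once, that respects the relative
precedences (a topological sorting). -/
def IsAbsolutePrecedence (Γ : Fin R → Option Cell) (Ω : Fin R → List M)
    (ord : List (Fin R)) : Prop :=
  ord.Nodup ∧ (∀ i, i ∈ ord ↔ i ∈ I) ∧ ord.Pairwise fun a b => ¬ Precedes m st I Γ Ω b a

open Classical in
/-- Breaking the precedence cycles: for a linear arrangement of the robots in which at least half of
the precedence edges point forward, the backward edges are removed, by inactivating the robots at
their tails, or those at their heads. -/
def BreakCycles (Γ : Fin R → Option Cell) (Ω : Fin R → List M) (Γ' : Fin R → Option Cell) : Prop :=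
  ∃ rank : Fin R → ℕ, Function.Injective rank ∧
    let edges := Finset.univ.filter fun e : Fin R × Fin R => Precedes m st I Γ Ω e.1 e.2
    let back := edges.filter fun e => rank e.2 < rank e.1
    2 * back.card ≤ edges.card ∧
      ((∀ i, Γ' i = if i ∈ back.image Prod.fst then none else Γ i) ∨
        (∀ i, Γ' i = if i ∈ back.image Prod.snd then none else Γ i))

open Classical in
/-- One step of the time parameterization. `H` holds the higher-priority robots and `P` their
paths. An active participant `i` gets the least start time offset for which it does not collide with
any robot in `H`; it is inactivated if there is none. -/
def offsetStep (Ω : Fin R → List M)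
    (a : (Fin R → Option Cell) × (Fin R → List M) × Finset (Fin R)) (i : Fin R) :
    (Fin R → Option Cell) × (Fin R → List M) × Finset (Fin R) :=
  let Γ := a.1
  let P := a.2.1
  let H := a.2.2
  if Γ i = none then (Γ, Function.update P i [], insert i H)
  else if h : ∃ n : ℕ, ∀ k ∈ H,
      ¬ m.Collide (st i) (List.replicate n m.halt ++ Ω i) (st k) (P k) then
    (Γ, Function.update P i (List.replicate (Nat.find h) m.halt ++ Ω i), insert i H)
  else (Function.update Γ i none, Function.update P i [], insert i H)

/-- The time parameterization, in the order `ord` of the participants; the non-participants, with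
their remaining paths `rem`, have the highest priority. -/
def timeParam (rem : Fin R → List M) (Γ : Fin R → Option Cell) (Ω : Fin R → List M)
    (ord : List (Fin R)) : (Fin R → Option Cell) × (Fin R → List M) × Finset (Fin R) :=
  ord.foldl (offsetStep m st Ω) (Γ, rem, Finset.univ \ I)

/-- The paths after some participants have been inactivated. -/
def adjustPaths (Γ : Fin R → Option Cell) (Ω : Fin R → List M) (i : Fin R) : List M :=
  if Γ i = none then [] else Ω i

end Planning

/-! ### The planner and the robots as a transition system -/

/-- Where the planner is. -/
inductive Phase (R : ℕ) (M : Type*)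
  /-- the service is receiving requests -/
  | collect
  /-- all requests have been received; the planning of a horizon begins -/
  | horizon
  /-- at the head of the loop that makes the participants' paths `Φ` collision-free -/
  | resolve (Γ : Fin R → Option Cell) (Φ : Fin R → List M)
  /-- the participants' paths `P` for the horizon have been determined -/
  | dispatch (P : Fin R → List M)
  /-- the planner has exited -/
  | exited

/-- A global state of the robots and the planner. -/
structure Config (R : ℕ) (Θ M : Type*) where
  /-- current states of the robots -/
  state : Fin R → State Θ
  /-- local views of the robots -/
  lview : Fin R → View
  /-- robots whose request has not been received yet -/
  pending : Finset (Fin R)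
  /-- global view -/
  gview : View
  /-- remaining paths, from the current states on; the empty one stands for `NULL` -/
  rem : Fin R → List M
  /-- participants -/
  par : Finset (Fin R)
  /-- inactive robots of the previous horizon -/
  inact : Finset (Fin R)
  /-- reserved goals -/
  reserved : Finset Cell
  /-- number of requests received -/
  nReq : ℕ
  /-- number of active robots -/
  nAct : ℕ
  /-- the full paths of the robots, as sequences of states -/
  full : Fin R → List (State Θ)
  phase : Phase R M

section System

variable {R : ℕ} {Θ M : Type*} (m : Motion Θ M) (X Y : ℕ) (free : Finset Cell)

/-- The initial configuration for the start states `s₀`: every robot has made its initial local view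
and sent its request. -/
def initial (s₀ : Fin R → State Θ) : Config R Θ M where
  state := s₀
  lview i := View.empty.observe X Y free ((Finset.univ.erase i).image fun k => (s₀ k).1) (s₀ i).1
  pending := Finset.univ
  gview := View.empty
  rem _ := []
  par := ∅
  inact := ∅
  reserved := ∅
  nReq := 0
  nAct := R
  full i := [s₀ i]
  phase := Phase.collect

/-- The service receives the request of robot `i`. -/
def receive (c : Config R Θ M) (i : Fin R) : Config R Θ M :=
  let par := if c.rem i = [] then insert i c.par else c.par
  let c' : Config R Θ M :=
    { c with
      pending := c.pending.erase i
      par := par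
      gview := c.gview.merge X Y (c.lview i)
      nReq := c.nReq + 1 }
  if c.nReq + 1 = c.nAct then { c' with par := par ∪ c.inact, phase := Phase.horizon } else c'

/-- The goals that are not reserved. -/
def Config.unassigned (c : Config R Θ M) : Finset Cell := c.gview.goal \ c.reserved

/-- The combined paths: `P` for the participants, the remaining paths for the other robots. -/
def combine (c : Config R Θ M) (P : Fin R → List M) (i : Fin R) : List M :=
  if i ∈ c.par then P i else c.rem i

/-- The robots whose combined path has non-zero length. -/
def activeRobots (c : Config R Θ M) (P : Fin R → List M) : Finset (Fin R) :=
  Finset.univ.filter fun i => 0 < (combine c P i).length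

/-- A horizon of length `l` with the combined paths for `P`. The paths are split after `l` steps;
the active robots follow the first parts synchronously, update their local views after every step,
and send new requests; the other robots stay where they are. -/
def execute (c : Config R Θ M) (P : Fin R → List M) (l : ℕ) : Config R Θ M :=
  let path := combine c P
  let act := activeRobots c P
  { state := fun i => m.final (c.state i) ((path i).take l)
    lview := fun i =>
      if i ∈ act then
        (List.range l).foldl
          (fun V t => V.observe X Y free
            ((Finset.univ.erase i).image fun k => m.pos (c.state k) (path k) (t + 1))
            (m.pos (c.state i) (path i) (t + 1)))
          (c.lview i)
      else c.lview i
    pending := act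
    gview := c.gview
    rem := fun i => (path i).drop l
    par := ∅
    inact := Finset.univ \ act
    reserved := (Finset.univ.filter fun i => 0 < ((path i).drop l).length).image
      fun i => (m.final (c.state i) (path i)).1
    nReq := 0
    nAct := act.card
    full := fun i => c.full i ++
      (if i ∈ act then (m.states (c.state i) ((path i).take l)).tail
        else List.replicate l (c.state i))
    phase := Phase.collect }

/-- The steps of the system. -/
inductive Step : Config R Θ M → Config R Θ M → Prop
  /-- A request is received. -/
  | receive (c : Config R Θ M) (i : Fin R) :
      c.phase = Phase.collect → i ∈ c.pending → Step c (receive X Y c i)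
  /-- There are unassigned goals: the planning for the participants begins. -/
  | assign (c : Config R Θ M) (Γ : Fin R → Option Cell) (Φ : Fin R → List M) :
      c.phase = Phase.horizon → c.unassigned ≠ ∅ →
      OptimalPaths m c.state c.par c.unassigned (c.gview.goal ∪ c.gview.cov) Γ Φ →
      Step c { c with phase := Phase.resolve Γ Φ }
  /-- There are no unassigned goals, but there are non-participants: the participants wait. -/
  | skip (c : Config R Θ M) :
      c.phase = Phase.horizon → c.unassigned = ∅ → c.par ≠ Finset.univ →
      Step c { c with phase := Phase.dispatch fun _ => [] }
  /-- There are neither unassigned goals nor non-participants: the planner exits. -/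
  | exit (c : Config R Θ M) :
      c.phase = Phase.horizon → c.unassigned = ∅ → c.par = Finset.univ →
      Step c { c with phase := Phase.exited }
  /-- The time parameterization inactivates no participant: the loop ends. -/
  | accept (c : Config R Θ M) (Γ : Fin R → Option Cell) (Φ : Fin R → List M)
      (Γ' : Fin R → Option Cell) (Ω : Fin R → List M) (ord : List (Fin R)) :
      c.phase = Phase.resolve Γ Φ → FeasiblePaths m c.state c.par Γ Φ Γ' Ω →
      IsAbsolutePrecedence m c.state c.par Γ' Ω ord →
      (timeParam m c.state c.par c.rem Γ' Ω ord).1 = Γ' →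
      Step c { c with phase := Phase.dispatch (timeParam m c.state c.par c.rem Γ' Ω ord).2.1 }
  /-- The time parameterization inactivates some participant: the loop is repeated. -/
  | reject (c : Config R Θ M) (Γ : Fin R → Option Cell) (Φ : Fin R → List M)
      (Γ' : Fin R → Option Cell) (Ω : Fin R → List M) (ord : List (Fin R))
      (Γ'' : Fin R → Option Cell) :
      c.phase = Phase.resolve Γ Φ → FeasiblePaths m c.state c.par Γ Φ Γ' Ω →
      IsAbsolutePrecedence m c.state c.par Γ' Ω ord →
      (timeParam m c.state c.par c.rem Γ' Ω ord).1 = Γ'' → Γ'' ≠ Γ' →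
      Step c { c with phase := Phase.resolve Γ'' (adjustPaths Γ'' Ω) }
  /-- There is no absolute precedence: cycles are broken and the loop is repeated. -/
  | breakCycles (c : Config R Θ M) (Γ : Fin R → Option Cell) (Φ : Fin R → List M)
      (Γ' : Fin R → Option Cell) (Ω : Fin R → List M) (Γ'' : Fin R → Option Cell) :
      c.phase = Phase.resolve Γ Φ → FeasiblePaths m c.state c.par Γ Φ Γ' Ω →
      (¬ ∃ ord, IsAbsolutePrecedence m c.state c.par Γ' Ω ord) →
      BreakCycles m c.state c.par Γ' Ω Γ'' →
      Step c { c with phase := Phase.resolve Γ'' (adjustPaths Γ'' Ω) }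
  /-- The horizon, whose length `l` is the least path length of an active robot, is executed. There
  is no such step if no robot is active; the service then waits for a request forever. -/
  | execute (c : Config R Θ M) (P : Fin R → List M) (l : ℕ) :
      c.phase = Phase.dispatch P →
      IsLeast {n | ∃ i ∈ activeRobots c P, n = (combine c P i).length} l →
      Step c (execute m X Y free c P l)

/-- The configurations that can occur in a run from the start states `s₀`. -/
def Reachable (s₀ : Fin R → State Θ) (c : Config R Θ M) : Prop :=
  Relation.ReflTransGen (Step m X Y free) (initial X Y free s₀) c

end System

end OnDemCPP

end

/-!
The planner terminates because every step decreases a triple of natural numbers in lexicographic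
order (`runMeasure`, `runMeasure_step`): the number of obstacle-free cells that are neither visited
nor reserved, the total length of the remaining paths, and a bound for the steps left in the current
horizon. In a horizon in which a participant becomes active, its goal, so far neither visited nor
reserved, gets visited or reserved; in any other one the robots on the move use up some of their
remaining paths (`runMeasure_execute`). Within a horizon, goal reassignment does not increase the
number of assigned participants, and each repetition of the planning loop decreases it
(`BreakCycles.ne`, `numAssigned_lt`).

The planner does not get stuck because some robot is active whenever a horizon is to be executed.
This is clear if there is a robot with a remaining path. Otherwise all robots are participants, and
some goal is unassigned. The goal is next to a cell visited by some robot, which can go back there,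
so the first assignment is not empty (`Sound.exists_isRoute`, `OptimalPaths.exists_active`), and no
part of the planning loop makes it empty: if all active participants are killed, the first path
processed revives somebody (`FeasiblePaths.exists_active`); of the active participants, the one of
least rank is no tail and the one of greatest rank no head of a backward precedence
(`BreakCycles.exists_active`); and the first active participant of an absolute precedence needs no
offset (`timeParam_exists_active`).

Coverage is complete on exit because an obstacle-free cell can be marked as an obstacle only where
another robot stands, and that robot reports the cell as covered. So once all requests have been
received, the obstacle-free neighbours of visited cells are covered or goals
(`GlobalSound.mem_region`); when no goals are left, connectedness shows that everything has been
visited (`Invariant.visited_eq`).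

All this rests on an invariant of the runs (`Invariant`). Its main point besides the views is that
the combined paths never collide. The time parameterization checks this for active participants
only; for an inactive one it holds as after goal reassignment no inactive participant is on the path
of an active one (`FeasiblePaths.isFeasible`, `foldl_offsetStep_paths`).
-/

namespace OnDemCPP

/-! ### Paths -/

section Paths

variable {Θ M : Type*} {m : Motion Θ M}

lemma states_nil (s : State Θ) : m.states s [] = [s] := by simp [Motion.states]

lemma states_cons (s : State Θ) (μ : M) (p : List M) :
    m.states s (μ :: p) = s :: m.states (m.next s μ) p := by simp [Motion.states]

lemma cells_nil (s : State Θ) : m.cells s [] = [s.1] := by simp [Motion.cells, states_nil]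

lemma cells_cons (s : State Θ) (μ : M) (p : List M) :
    m.cells s (μ :: p) = s.1 :: m.cells (m.next s μ) p := by simp [Motion.cells, states_cons]

lemma final_nil (s : State Θ) : m.final s [] = s := rfl

lemma final_cons (s : State Θ) (μ : M) (p : List M) :
    m.final s (μ :: p) = m.final (m.next s μ) p := rfl

lemma final_append (s : State Θ) (p q : List M) :
    m.final s (p ++ q) = m.final (m.final s p) q := by simp [Motion.final]

lemma states_length (s : State Θ) (p : List M) : (m.states s p).length = p.length + 1 := by
  simp [Motion.states]

lemma states_eq_cons (s : State Θ) (p : List M) : ∃ l, m.states s p = s :: l := by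
  cases p with
  | nil => exact ⟨[], states_nil s⟩
  | cons μ p => exact ⟨_, states_cons s μ p⟩

lemma cells_eq_cons (s : State Θ) (p : List M) : ∃ l, m.cells s p = s.1 :: l := by
  obtain ⟨l, hl⟩ := states_eq_cons (m := m) s p
  exact ⟨l.map Prod.fst, by simp [Motion.cells, hl]⟩

lemma states_append (s : State Θ) (p q : List M) :
    m.states s (p ++ q) = m.states s p ++ (m.states (m.final s p) q).tail := by
  induction p generalizing s with
  | nil =>
    obtain ⟨l, hl⟩ := states_eq_cons (m := m) s q
    simp [states_nil, final_nil, hl]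
  | cons μ p ih => simp [states_cons, final_cons, ih]

lemma states_getElem (s : State Θ) (p : List M) (t : ℕ) (ht : t < (m.states s p).length) :
    (m.states s p)[t] = m.final s (p.take t) := by
  simp [Motion.states, Motion.final, List.getElem_scanl]

lemma mem_cells_iff {s : State Θ} {p : List M} {c : Cell} :
    c ∈ m.cells s p ↔ ∃ t ≤ p.length, m.pos s p t = c := by
  rw [Motion.cells, List.mem_map]
  constructor
  · rintro ⟨x, hx, rfl⟩
    obtain ⟨t, ht, rfl⟩ := List.mem_iff_getElem.1 hx
    rw [states_getElem]
    rw [states_length] at ht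
    exact ⟨t, by omega, rfl⟩
  · rintro ⟨t, ht, rfl⟩
    have ht : t < (m.states s p).length := by rw [states_length]; omega
    exact ⟨_, List.getElem_mem ht, by rw [states_getElem]; rfl⟩

lemma pos_of_length_le {s : State Θ} {p : List M} {t : ℕ} (ht : p.length ≤ t) :
    m.pos s p t = (m.final s p).1 := by
  simp [Motion.pos, List.take_of_length_le ht]

lemma pos_zero (s : State Θ) (p : List M) : m.pos s p 0 = s.1 := by
  simp [Motion.pos, final_nil]

lemma pos_nil (s : State Θ) (t : ℕ) : m.pos s [] t = s.1 := by
  simp [Motion.pos, final_nil]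

lemma pos_mem_cells (s : State Θ) (p : List M) (t : ℕ) : m.pos s p t ∈ m.cells s p := by
  rcases le_total t p.length with h | h
  · exact mem_cells_iff.2 ⟨t, h, rfl⟩
  · exact mem_cells_iff.2 ⟨_, le_rfl, by rw [pos_of_length_le h, pos_of_length_le le_rfl]⟩

lemma start_mem_cells (s : State Θ) (p : List M) : s.1 ∈ m.cells s p := by
  simpa [pos_zero] using pos_mem_cells (m := m) s p 0

lemma final_mem_cells (s : State Θ) (p : List M) : (m.final s p).1 ∈ m.cells s p := by
  simpa [pos_of_length_le] using pos_mem_cells (m := m) s p p.length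

lemma pos_add (s : State Θ) (p : List M) (a t : ℕ) :
    m.pos s p (a + t) = m.pos (m.final s (p.take a)) (p.drop a) t := by
  simp only [Motion.pos, ← final_append, List.take_add]

lemma cells_append_tail (s : State Θ) (p q : List M) :
    m.cells s (p ++ q) = m.cells s p ++ (m.cells (m.final s p) q).tail := by
  simp [Motion.cells, states_append]

lemma mem_cells_append {s : State Θ} {p q : List M} {c : Cell} :
    c ∈ m.cells s (p ++ q) ↔ c ∈ m.cells s p ∨ c ∈ m.cells (m.final s p) q := by
  obtain ⟨l, hl⟩ := cells_eq_cons (m := m) (m.final s p) q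
  rw [cells_append_tail, hl, List.mem_append, List.tail_cons, List.mem_cons]
  constructor
  · tauto
  · rintro (h | rfl | h)
    · exact .inl h
    · exact .inl (final_mem_cells s p)
    · exact .inr h

lemma cells_getLast? (s : State Θ) (p : List M) :
    (m.cells s p).getLast? = some (m.final s p).1 := by
  induction p generalizing s with
  | nil => simp [cells_nil, final_nil]
  | cons μ p ih =>
    rw [cells_cons, List.getLast?_cons, ih, final_cons]
    rfl

lemma mem_cells_take {s : State Θ} {p : List M} {a : ℕ} {c : Cell}
    (h : c ∈ m.cells s (p.take a)) : c ∈ m.cells s p := by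
  rw [← List.take_append_drop a p, mem_cells_append]
  exact .inl h

lemma mem_cells_drop {s : State Θ} {p : List M} {a : ℕ} {c : Cell}
    (h : c ∈ m.cells (m.final s (p.take a)) (p.drop a)) : c ∈ m.cells s p := by
  rw [← List.take_append_drop a p, mem_cells_append]
  exact .inr h

lemma Motion.Admissible.next_halt (hm : m.Admissible) (s : State Θ) : m.next s m.halt = s := by
  simp [Motion.next, hm.halt_turn, hm.halt_disp]

lemma states_replicate_halt (hm : m.Admissible) (s : State Θ) (n : ℕ) :
    m.states s (List.replicate n m.halt) = List.replicate (n + 1) s := by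
  induction n with
  | zero => simp [states_nil]
  | succ n ih => rw [List.replicate_succ, states_cons, hm.next_halt, ih]; rfl

lemma final_replicate_halt (hm : m.Admissible) (s : State Θ) (n : ℕ) :
    m.final s (List.replicate n m.halt) = s := by
  induction n with
  | zero => simp [final_nil]
  | succ n ih => rw [List.replicate_succ, final_cons, hm.next_halt, ih]

lemma final_wait_append (hm : m.Admissible) (s : State Θ) (n : ℕ) (p : List M) :
    m.final s (List.replicate n m.halt ++ p) = m.final s p := by
  rw [final_append, final_replicate_halt hm]

lemma mem_cells_wait_append (hm : m.Admissible) {s : State Θ} {n : ℕ} {p : List M} {c : Cell} :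
    c ∈ m.cells s (List.replicate n m.halt ++ p) ↔ c ∈ m.cells s p := by
  rw [mem_cells_append, final_replicate_halt hm]
  constructor
  · rintro (h | h)
    · simp only [Motion.cells, states_replicate_halt hm, List.map_replicate,
        List.mem_replicate] at h
      rw [h.2]
      exact start_mem_cells s p
    · exact h
  · exact .inr

lemma mem_nbrs_comm {p q : Cell} : p ∈ nbrs q ↔ q ∈ nbrs p := by
  have h : ∀ p q : Cell, p ∈ nbrs q → q ∈ nbrs p := by
    intro p q h
    simp only [nbrs, dirs, Finset.mem_image, Finset.mem_insert, Finset.mem_singleton] at h ⊢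
    obtain ⟨d, hd, rfl⟩ := h
    refine ⟨-d, ?_, by simp⟩
    rcases hd with rfl | rfl | rfl | rfl <;> simp
  exact ⟨h p q, h q p⟩

lemma next_cell (hm : m.Admissible) (s : State Θ) (μ : M) :
    (m.next s μ).1 = s.1 ∨ (m.next s μ).1 ∈ nbrs s.1 := by
  rcases hm.disp_mem μ s.2 with h | h
  · left; simp [Motion.next, h]
  · right; exact Finset.mem_image.2 ⟨_, h, rfl⟩

lemma isChain_cells (hm : m.Admissible) (s : State Θ) (p : List M) :
    (m.cells s p).IsChain fun a b => b = a ∨ b ∈ nbrs a := by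
  induction p generalizing s with
  | nil => simp [cells_nil]
  | cons μ p ih =>
    obtain ⟨l, hl⟩ := cells_eq_cons (m := m) (m.next s μ) p
    have := ih (m.next s μ)
    rw [cells_cons, hl]
    rw [hl] at this
    exact List.isChain_cons_cons.2 ⟨next_cell hm s μ, this⟩

/-- From the end of a path, all its cells can be reached within the path. -/
lemma final_reaches_cells (hm : m.Admissible) (s : State Θ) (p : List M) (S : Set Cell)
    (hS : ∀ c ∈ m.cells s p, c ∈ S) {c : Cell} (hc : c ∈ m.cells s p) :
    Relation.ReflTransGen (fun a b => b ∈ nbrs a ∧ b ∈ S) (m.final s p).1 c := by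
  induction p generalizing s c with
  | nil =>
    simp only [cells_nil, List.mem_singleton] at hc
    rw [hc, final_nil]
  | cons μ p ih =>
    rw [cells_cons] at hc hS
    rw [final_cons]
    have hS' := fun c h => hS c (List.mem_cons_of_mem _ h)
    rcases List.mem_cons.1 hc with rfl | hc
    · have h0 := ih (m.next s μ) hS' (start_mem_cells _ _)
      rcases next_cell hm s μ with h | h
      · rwa [h] at h0
      · exact h0.tail ⟨mem_nbrs_comm.1 h, hS _ List.mem_cons_self⟩
    · exact ih _ hS' hc

/-- A robot can turn in its cell and then move to a given neighbouring cell; the cells of such a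
manoeuvre, continued by any path, are repetitions of its cell followed by those of that path. -/
lemma exists_move (hm : m.Admissible) (s : State Θ) {c : Cell} (hc : c ∈ nbrs s.1) :
    ∃ (w : List M) (n : ℕ), (m.final s w).1 = c ∧
      ∀ w', m.cells s (w ++ w') = List.replicate (n + 1) s.1 ++ m.cells (m.final s w) w' := by
  obtain ⟨d, hd, rfl⟩ := Finset.mem_image.1 hc
  obtain ⟨a, θ⟩ := s
  obtain ⟨θ', hθ, μ, hμ⟩ := hm.mobile θ d hd
  clear hc
  induction hθ using Relation.ReflTransGen.head_induction_on with
  | refl => exact ⟨[μ], 0, by simp [final_cons, final_nil, Motion.next, hμ],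
      fun w' => by simp [cells_cons, final_cons, final_nil]⟩
  | @head θ₀ θ₁ h _ ih =>
    obtain ⟨ν, h0, rfl⟩ := h
    obtain ⟨w, n, h1, h2⟩ := ih
    have hn : m.next (a, θ₀) ν = (a, m.turn ν θ₀) := by simp [Motion.next, h0]
    refine ⟨ν :: w, n + 1, by rw [final_cons, hn]; exact h1, fun w' => ?_⟩
    rw [List.cons_append, cells_cons, final_cons, hn, h2, List.replicate_succ (n := n + 1)]
    rfl

lemma destutter'_replicate_append (c : Cell) (n : ℕ) (l : List Cell) :
    (List.replicate n c ++ l).destutter' (· ≠ ·) c = l.destutter' (· ≠ ·) c := by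
  induction n with
  | zero => rfl
  | succ n ih =>
    rw [List.replicate_succ, List.cons_append, List.destutter'_cons_neg _ (by simp), ih]

lemma exists_path_along (hm : m.Admissible) (l : List Cell) (s : State Θ)
    (h : (s.1 :: l).IsChain fun a b => b = a ∨ b ∈ nbrs a) :
    ∃ w, (m.cells s w).destutter (· ≠ ·) = (s.1 :: l).destutter (· ≠ ·) := by
  induction l generalizing s with
  | nil => exact ⟨[], by rw [cells_nil]⟩
  | cons d l ih =>
    obtain ⟨hd, hl⟩ := List.isChain_cons_cons.1 h
    by_cases hds : d = s.1
    · subst hds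
      obtain ⟨w, hw⟩ := ih s hl
      refine ⟨w, ?_⟩
      rw [hw, List.destutter_cons', List.destutter_cons', List.destutter'_cons_neg _ (by simp)]
    · obtain ⟨w, n, rfl, h2⟩ := exists_move hm s (hd.resolve_left hds)
      obtain ⟨w', hw'⟩ := ih _ hl
      refine ⟨w ++ w', ?_⟩
      obtain ⟨l', hl'⟩ := cells_eq_cons (m := m) (m.final s w) w'
      rw [h2, hl', List.replicate_succ, List.cons_append, List.destutter_cons',
        destutter'_replicate_append, List.destutter_cons',
        List.destutter'_cons_pos _ (Ne.symm hds), List.destutter'_cons_pos _ (Ne.symm hds)]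
      rw [hl', List.destutter_cons', List.destutter_cons'] at hw'
      rw [hw']

lemma mem_destutter'_iff {c a : Cell} {l : List Cell} :
    c ∈ l.destutter' (· ≠ ·) a ↔ c ∈ a :: l := by
  induction l generalizing a with
  | nil => simp
  | cons b l ih =>
    by_cases h : a = b
    · subst h
      rw [List.destutter'_cons_neg _ (by simp), ih]
      simp
    · rw [List.destutter'_cons_pos _ h, List.mem_cons, ih, List.mem_cons (l := b :: l)]

lemma getLast?_destutter' (a : Cell) (l : List Cell) :
    (l.destutter' (· ≠ ·) a).getLast? = (a :: l).getLast? := by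
  induction l generalizing a with
  | nil => simp
  | cons b l ih =>
    by_cases h : a = b
    · subst h
      rw [List.destutter'_cons_neg _ (by simp), ih]
      simp [List.getLast?_cons]
    · rw [List.destutter'_cons_pos _ h, List.getLast?_cons, ih]
      simp [List.getLast?_cons]

/-- A path that follows given cells up to repetitions visits exactly these cells and has the same
last cell. -/
lemma cells_of_destutter_eq {s : State Θ} {w : List M} {a : Cell} {l : List Cell}
    (h : (m.cells s w).destutter (· ≠ ·) = (a :: l).destutter (· ≠ ·)) :
    (∀ c, c ∈ m.cells s w ↔ c ∈ a :: l) ∧ (a :: l).getLast? = some (m.final s w).1 := by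
  rw [← cells_getLast?]
  obtain ⟨l', hl'⟩ := cells_eq_cons (m := m) s w
  rw [hl', List.destutter_cons', List.destutter_cons'] at h
  rw [hl']
  refine ⟨fun c => ?_, ?_⟩
  · rw [← mem_destutter'_iff, h, mem_destutter'_iff]
  · rw [← getLast?_destutter', ← h, getLast?_destutter']

lemma exists_path_of_reaches (hm : m.Admissible) {region : Finset Cell} (s : State Θ) {γ : Cell}
    (hs : s.1 ∈ region)
    (h : Relation.ReflTransGen (fun a b => b ∈ nbrs a ∧ b ∈ region) s.1 γ) :
    ∃ p, (∀ c ∈ m.cells s p, c ∈ region) ∧ (m.final s p).1 = γ := by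
  induction h with
  | refl => exact ⟨[], by simpa [cells_nil] using hs, rfl⟩
  | @tail b c _ hbc ih =>
    obtain ⟨p, hp, rfl⟩ := ih
    obtain ⟨w, n, hw, hcells⟩ := exists_move hm (m.final s p) hbc.1
    refine ⟨p ++ w, fun x hx => ?_, by rw [final_append, hw]⟩
    rcases mem_cells_append.1 hx with hx | hx
    · exact hp x hx
    · have h0 := hcells []
      rw [List.append_nil, cells_nil] at h0
      rw [h0, List.mem_append, List.mem_replicate, List.mem_singleton] at hx
      rcases hx with ⟨_, rfl⟩ | rfl
      · exact hp _ (final_mem_cells s p)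
      · rw [hw]; exact hbc.2

/-- A path of least length to a cell is a route: it repeats no state and stops on arrival. -/
lemma exists_isRoute {region : Finset Cell} {s : State Θ} {γ : Cell} {p : List M}
    (hp : ∀ c ∈ m.cells s p, c ∈ region) (hγ : (m.final s p).1 = γ) :
    ∃ p', m.IsRoute region s γ p' := by
  induction hn : p.length using Nat.strong_induction_on generalizing p with
  | _ n ih =>
    subst hn
    by_cases h1 : ∃ t < p.length, m.pos s p t = γ
    · obtain ⟨t, ht, h1⟩ := h1
      exact ih _ (by simpa using ht) (p := p.take t) (fun c hc => hp c (mem_cells_take hc)) h1 rfl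
    by_cases h2 : (m.states s p).Nodup
    · exact ⟨p, h2, hp, hγ, fun t ht h => h1 ⟨t, ht, h⟩⟩
    · rw [List.Nodup, List.pairwise_iff_getElem] at h2
      push Not at h2
      obtain ⟨a, b, ha, hb, hab, h2⟩ := h2
      rw [states_getElem, states_getElem] at h2
      rw [states_length] at hb
      refine ih _ ?_ (p := p.take a ++ p.drop b) (fun c hc => hp c ?_) ?_ rfl
      · simp; omega
      · rw [mem_cells_append, h2] at hc
        exact hc.elim mem_cells_take mem_cells_drop
      · rw [final_append, h2, ← final_append, List.take_append_drop, hγ]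

lemma finite_isRoute [Finite Θ] [Finite M] (region : Finset Cell) (s : State Θ) (γ : Cell) :
    {p | m.IsRoute region s γ p}.Finite := by
  have := Fintype.ofFinite Θ
  classical
  refine (List.finite_length_le M (region ×ˢ (Finset.univ : Finset Θ)).card).subset ?_
  rintro p ⟨hnd, hcells, -⟩
  have h : (m.states s p).toFinset ⊆ region ×ˢ Finset.univ := by
    intro x hx
    rw [List.mem_toFinset] at hx
    exact Finset.mem_product.2 ⟨hcells _ (List.mem_map_of_mem hx), Finset.mem_univ _⟩
  have h := Finset.card_le_card h
  rw [List.toFinset_card_of_nodup hnd, states_length] at h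
  exact (Nat.le_succ _).trans h

lemma exists_isOptRoute [Finite Θ] [Finite M] {region : Finset Cell} {s : State Θ} {γ : Cell}
    (h : ∃ p, m.IsRoute region s γ p) : ∃ p, m.IsOptRoute region s γ p := by
  obtain ⟨p, hp, hmin⟩ := Set.exists_min_image _ m.pathCost
    (finite_isRoute (m := m) region s γ) h
  exact ⟨p, hp, hmin⟩

lemma collide_comm {s s' : State Θ} {p p' : List M} :
    m.Collide s p s' p' ↔ m.Collide s' p' s p := by
  have h : ∀ {s s' : State Θ} {p p' : List M}, m.Collide s p s' p' → m.Collide s' p' s p := by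
    rintro s s' p p' ⟨t, h | ⟨h1, h2⟩⟩
    · exact ⟨t, .inl h.symm⟩
    · exact ⟨t, .inr ⟨h2.symm, h1.symm⟩⟩
  exact ⟨h, h⟩

lemma not_collide_nil {s s' : State Θ} {p : List M} (h : s'.1 ∉ m.cells s p) :
    ¬ m.Collide s p s' [] := by
  rintro ⟨t, h' | ⟨h', -⟩⟩ <;> rw [pos_nil] at h' <;> exact h (h' ▸ pos_mem_cells s p t)

lemma not_collide_drop {s s' : State Θ} {p p' : List M} (h : ¬ m.Collide s p s' p') (l : ℕ) :
    ¬ m.Collide (m.final s (p.take l)) (p.drop l) (m.final s' (p'.take l)) (p'.drop l) := by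
  rintro ⟨t, ht⟩
  simp only [← pos_add] at ht
  exact h ⟨l + t, ht⟩

end Paths

/-! ### Goal assignment -/

section Planning

variable {R : ℕ} {Θ M : Type*} {m : Motion Θ M} {st : Fin R → State Θ} {I : Finset (Fin R)}
  {targets region : Finset Cell}

lemma numAssigned_lt {Γ Γ' : Fin R → Option Cell} (h : ∀ i, Γ' i = Γ i ∨ Γ' i = none)
    (hne : Γ' ≠ Γ) : numAssigned Γ' < numAssigned Γ := by
  obtain ⟨i, hi⟩ := Function.ne_iff.1 hne
  refine Finset.card_lt_card (Finset.ssubset_iff_of_subset ?_ |>.2 ⟨i, ?_, ?_⟩)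
  · intro k hk
    rw [Finset.mem_filter] at hk ⊢
    rcases h k with h | h
    · rwa [← h]
    · simp [h] at hk
  · rcases h i with h | h
    · exact absurd h hi
    · rw [h] at hi
      simpa [Option.isSome_iff_ne_none] using Ne.symm hi
  · rcases h i with h | h
    · exact absurd h hi
    · simp [h]

lemma numAssigned_update_le (Γ : Fin R → Option Cell) (j : Fin R) (o : Option Cell) :
    numAssigned (Function.update Γ j o) ≤ numAssigned Γ + 1 := by
  refine (Finset.card_le_card (t := insert j (Finset.univ.filter fun i => (Γ i).isSome = true))
    ?_).trans (Finset.card_insert_le _ _)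
  intro k hk
  by_cases h : k = j
  · simp [h]
  · simpa [h] using hk

lemma finite_isAssignment : {Γ | IsAssignment m st I targets region Γ}.Finite := by
  refine (Set.Finite.pi' (t := fun _ : Fin R => {o : Option Cell | ∀ γ, o = some γ → γ ∈ targets})
    fun _ => ?_).subset fun Γ hΓ i γ h => (hΓ.1 i γ h).2.1
  refine ((targets.finite_toSet.image some).insert none).subset ?_
  rintro (_ | γ) h
  · simp
  · exact .inr ⟨γ, h γ rfl, rfl⟩

lemma exists_optimalPaths [Finite Θ] [Finite M] (m : Motion Θ M) (st : Fin R → State Θ)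
    (I : Finset (Fin R)) (targets region : Finset Cell) :
    ∃ Γ Φ, OptimalPaths m st I targets region Γ Φ := by
  have hL : ∀ (i : Fin R) (γ : Cell), ∃ p : List M, (∃ p, m.IsRoute region (st i) γ p) →
      m.IsOptRoute region (st i) γ p := by
    intro i γ
    by_cases h : ∃ p, m.IsRoute region (st i) γ p
    · obtain ⟨p, hp⟩ := exists_isOptRoute h
      exact ⟨p, fun _ => hp⟩
    · exact ⟨[], fun h' => absurd h' h⟩
  choose L hL using hL
  have hfin := finite_isAssignment (m := m) (st := st) (I := I) (targets := targets)
    (region := region)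
  obtain ⟨Γ₀, hΓ₀, hmax⟩ := Set.exists_max_image _ numAssigned hfin ⟨fun _ => none, by
    simp [IsAssignment]⟩
  obtain ⟨Γ, ⟨hΓ, hcard⟩, hmin⟩ := Set.exists_min_image
    {Γ | IsAssignment m st I targets region Γ ∧ numAssigned Γ = numAssigned Γ₀}
    (assignCost m L) (hfin.subset fun _ h => h.1) ⟨Γ₀, hΓ₀, rfl⟩
  refine ⟨Γ, fun i => (Γ i).elim [] (L i), L, fun i _ γ _ h => hL i γ h, hΓ, fun Γ' h' => ?_,
    fun _ => rfl⟩
  rw [hcard]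
  exact ⟨hmax _ h', fun he => hmin _ ⟨h', he⟩⟩

/-- If some participant can reach some goal, an assignment of the largest possible number of
participants assigns at least one. -/
lemma OptimalPaths.exists_active {Γ : Fin R → Option Cell} {Φ : Fin R → List M}
    (h : OptimalPaths m st I targets region Γ Φ) {i : Fin R} {γ : Cell} (hi : i ∈ I)
    (hγ : γ ∈ targets) (hp : ∃ p, m.IsRoute region (st i) γ p) : ∃ i, Γ i ≠ none := by
  obtain ⟨L, -, -, hmax, -⟩ := h
  have h1 := (hmax (Function.update (fun _ => none) i (some γ)) ⟨fun j γ' hj => ?_,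
    fun j k γ' hj hk => ?_⟩).1
  · have h2 : 0 < numAssigned (Function.update (fun _ => none) i (some γ)) :=
      Finset.card_pos.2 ⟨i, by simp⟩
    obtain ⟨j, hj⟩ := Finset.card_pos.1 (h2.trans_le h1)
    rw [Finset.mem_filter, Option.isSome_iff_ne_none] at hj
    exact ⟨j, hj.2⟩
  · by_cases hji : j = i
    · subst hji
      rw [Function.update_self, Option.some_inj] at hj
      subst hj
      exact ⟨hi, hγ, hp⟩
    · simp [hji] at hj
  · have : ∀ j, Function.update (fun _ => none) i (some γ) j = some γ' → j = i := by
      intro j hj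
      by_contra hji
      simp [hji] at hj
    rw [this j hj, this k hk]

/-- What the planning loop preserves about an assignment and its paths: an inactive robot has the
zero-length path, and an assigned one is a participant whose path leads to its goal, one of
`targets`, within `region`. -/
structure IsPlan (m : Motion Θ M) (st : Fin R → State Θ) (I : Finset (Fin R))
    (targets region : Finset Cell) (Γ : Fin R → Option Cell) (Φ : Fin R → List M) : Prop where
  path_eq_nil : ∀ i, Γ i = none → Φ i = []
  mem : ∀ i γ, Γ i = some γ → i ∈ I ∧ γ ∈ targets
  final : ∀ i γ, Γ i = some γ → (m.final (st i) (Φ i)).1 = γ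
  cells : ∀ i γ, Γ i = some γ → ∀ c ∈ m.cells (st i) (Φ i), c ∈ region

lemma OptimalPaths.isPlan {Γ : Fin R → Option Cell} {Φ : Fin R → List M}
    (h : OptimalPaths m st I targets region Γ Φ) : IsPlan m st I targets region Γ Φ := by
  obtain ⟨L, hL, hΓ, -, hΦ⟩ := h
  have key : ∀ i γ, Γ i = some γ → m.IsRoute region (st i) γ (Φ i) := by
    intro i γ hi
    obtain ⟨h1, h2, h3⟩ := hΓ.1 i γ hi
    rw [hΦ, hi]
    exact (hL i h1 γ h2 h3).1
  exact ⟨fun i hi => by rw [hΦ, hi]; rfl, fun i γ hi => ⟨(hΓ.1 i γ hi).1, (hΓ.1 i γ hi).2.1⟩,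
    fun i γ hi => (key i γ hi).2.2.1, fun i γ hi => (key i γ hi).2.1⟩

lemma IsPlan.adjustPaths {Γ Γ' : Fin R → Option Cell} {Φ : Fin R → List M}
    (h : IsPlan m st I targets region Γ Φ) (h' : ∀ i, Γ' i = Γ i ∨ Γ' i = none) :
    IsPlan m st I targets region Γ' (adjustPaths Γ' Φ) := by
  have key : ∀ i γ, Γ' i = some γ → Γ i = some γ ∧ OnDemCPP.adjustPaths Γ' Φ i = Φ i := by
    intro i γ hi
    refine ⟨?_, by simp [OnDemCPP.adjustPaths, hi]⟩
    rcases h' i with h | h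
    · rw [← h, hi]
    · rw [h] at hi; cases hi
  refine ⟨fun i hi => by simp [OnDemCPP.adjustPaths, hi], fun i γ hi => h.mem i γ (key i γ hi).1,
    fun i γ hi => ?_, fun i γ hi => ?_⟩
  · rw [(key i γ hi).2]; exact h.final i γ (key i γ hi).1
  · rw [(key i γ hi).2]; exact h.cells i γ (key i γ hi).1

/-! ### Goal reassignment -/

lemma infeasible_comm {Γ : Fin R → Option Cell} {Φ : Fin R → List M} {i j : Fin R} :
    Infeasible m st Γ Φ i j ↔ Infeasible m st Γ Φ j i := by
  simp only [Infeasible, Crossover, Nested]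
  tauto

/-- No two participants form an infeasible pair. -/
def IsFeasible (m : Motion Θ M) (st : Fin R → State Θ) (I : Finset (Fin R))
    (Γ : Fin R → Option Cell) (Φ : Fin R → List M) : Prop :=
  ∀ i ∈ I, ∀ j ∈ I, i ≠ j → ¬ Infeasible m st Γ Φ i j

lemma Killed.mem_and_active {Γ : Fin R → Option Cell} {Φ : Fin R → List M} {i : Fin R}
    (h : Killed m st I Γ Φ i) : i ∈ I ∧ Γ i ≠ none := by
  cases h with
  | pair _ _ h1 _ _ h2 _ => exact ⟨h1, h2⟩
  | blocked _ _ h1 _ h2 _ _ => exact ⟨h1, h2⟩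

open Classical in
lemma isFeasible_kill (Γ : Fin R → Option Cell) (Φ : Fin R → List M) :
    IsFeasible m st I (fun i => if Killed m st I Γ Φ i then none else Γ i)
      (fun i => if Killed m st I Γ Φ i then [] else Φ i) := by
  -- An inactive participant is not on the path of a surviving one.
  have key : ∀ i ∈ I, ∀ j ∈ I, i ≠ j → ¬ Killed m st I Γ Φ j → Γ j ≠ none →
      (if Killed m st I Γ Φ i then none else Γ i) = none → ¬ StartOn m st Φ i j := by
    intro i hi j hj hij hk hΓj h hs
    by_cases hki : Killed m st I Γ Φ i
    · exact hk (.blocked j i hj hij.symm hΓj hki hs)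
    · rw [if_neg hki] at h
      exact hk (.pair j i hj hi hij.symm hΓj (.inl (.inr (.inl ⟨h, hΓj, hs⟩))))
  have hA : ∀ i, (if Killed m st I Γ Φ i then none else Γ i) ≠ none →
      ¬ Killed m st I Γ Φ i ∧ Γ i ≠ none := by
    intro i h
    by_cases hki : Killed m st I Γ Φ i
    · simp [hki] at h
    · exact ⟨hki, by simpa [hki] using h⟩
  rintro i hi j hj hij ((⟨h1, h2, h3⟩ | ⟨h1, h2, h3⟩ | ⟨h1, h2, h3, h4⟩) | ⟨h1, h2, h3⟩)
  · obtain ⟨hk, hj'⟩ := hA j h2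
    exact key i hi j hj hij hk hj' h1 (by simpa [StartOn, hk] using h3)
  · obtain ⟨hk, hj'⟩ := hA i h2
    exact key j hj i hi hij.symm hk hj' h1 (by simpa [StartOn, hk] using h3)
  · obtain ⟨hki, hi'⟩ := hA i h1
    obtain ⟨hkj, hj'⟩ := hA j h2
    simp only [StartOn, hki, hkj, if_false] at h3 h4
    exact hki (.pair i j hi hj hij hi' (.inl (.inr (.inr ⟨hi', hj', h3, h4⟩))))
  · obtain ⟨hki, hi'⟩ := hA i h1
    obtain ⟨hkj, hj'⟩ := hA j h2
    simp only [StartOn, GoalOn, hki, hkj, if_false] at h3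
    exact hki (.pair i j hi hj hij hi' (.inr ⟨hi', hj', h3⟩))

lemma Revive.isFeasible {Γ : Fin R → Option Cell} {Φ : Fin R → List M} {ks : List (Fin R)}
    {Γ₁ Γ₂ : Fin R → Option Cell} {Ω₁ Ω₂ : Fin R → List M}
    (h : Revive m st I Γ Φ ks Γ₁ Ω₁ Γ₂ Ω₂) (h₁ : IsFeasible m st I Γ₁ Ω₁) :
    IsFeasible m st I Γ₂ Ω₂ := by
  induction h with
  | nil => exact h₁
  | skip i ks Γ₁ Ω₁ Γ₂ Ω₂ _ _ ih => exact ih h₁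
  | fail i ks Γ₁ Ω₁ Γ₂ Ω₂ j w _ _ _ ih => exact ih h₁
  | revive i ks Γ₁ Ω₁ Γ₂ Ω₂ j w _ hnc _ ih =>
    refine ih fun a ha b hb hab => ?_
    by_cases haj : a = j
    · subst haj
      exact hnc b hb hab.symm
    by_cases hbj : b = j
    · subst hbj
      rw [infeasible_comm]
      exact hnc a ha hab
    · have := h₁ a ha b hb hab
      simpa [Infeasible, Crossover, Nested, StartOn, GoalOn, haj, hbj] using this

lemma Candidate.cells_and_final {Γ' : Fin R → Option Cell} {i j : Fin R} {p w : List M}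
    (h : Candidate m st I Γ' i p j w) :
    (∀ c ∈ m.cells (st j) w, c ∈ m.cells (st i) p) ∧
      (m.final (st j) w).1 = (m.final (st i) p).1 := by
  obtain ⟨-, -, pre, suf, h1, -, h2⟩ := h
  obtain ⟨h3, h4⟩ := cells_of_destutter_eq h2
  refine ⟨fun c hc => ?_, ?_⟩
  · rw [h1, List.mem_append]
    exact .inr ((h3 c).1 hc)
  · have h5 := cells_getLast? (m := m) (st i) p
    rw [h1, List.getLast?_append, h4, Option.some_or] at h5
    exact Option.some_inj.1 h5

lemma Revive.isPlan {Γ : Fin R → Option Cell} {Φ : Fin R → List M} {ks : List (Fin R)}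
    {Γ₁ Γ₂ : Fin R → Option Cell} {Ω₁ Ω₂ : Fin R → List M}
    (h : Revive m st I Γ Φ ks Γ₁ Ω₁ Γ₂ Ω₂) (h₀ : IsPlan m st I targets region Γ Φ)
    (hks : ∀ i ∈ ks, Γ i ≠ none) (h₁ : IsPlan m st I targets region Γ₁ Ω₁) :
    IsPlan m st I targets region Γ₂ Ω₂ := by
  induction h with
  | nil => exact h₁
  | skip i ks Γ₁ Ω₁ Γ₂ Ω₂ _ _ ih => exact ih (fun k hk => hks k (.tail _ hk)) h₁
  | fail i ks Γ₁ Ω₁ Γ₂ Ω₂ j w _ _ _ ih => exact ih (fun k hk => hks k (.tail _ hk)) h₁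
  | revive i ks Γ₁ Ω₁ Γ₂ Ω₂ j w hc hnc _ ih =>
    refine ih (fun k hk => hks k (.tail _ hk)) ?_
    obtain ⟨hcells, hfin⟩ := hc.cells_and_final
    have hi := hks i (.head _)
    refine ⟨fun a ha => ?_, fun a γ ha => ?_, fun a γ ha => ?_, fun a γ ha => ?_⟩
    all_goals
      by_cases haj : a = j
      · subst haj
        simp only [Function.update_self] at ha ⊢
        first
          | exact absurd ha hi
          | exact ⟨hc.1, (h₀.mem i γ ha).2⟩
          | exact hfin.trans (h₀.final i γ ha)
          | exact fun c hc => h₀.cells i γ ha c (hcells c hc)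
      · simp only [Function.update_of_ne haj] at ha ⊢
        first
          | exact h₁.path_eq_nil a ha
          | exact h₁.mem a γ ha
          | exact h₁.final a γ ha
          | exact h₁.cells a γ ha

lemma Revive.numAssigned_le {Γ : Fin R → Option Cell} {Φ : Fin R → List M} {ks : List (Fin R)}
    {Γ₁ Γ₂ : Fin R → Option Cell} {Ω₁ Ω₂ : Fin R → List M}
    (h : Revive m st I Γ Φ ks Γ₁ Ω₁ Γ₂ Ω₂) :
    numAssigned Γ₂ ≤ numAssigned Γ₁ + ks.length := by
  induction h with
  | nil => simp
  | skip i ks Γ₁ Ω₁ Γ₂ Ω₂ _ _ ih => simp only [List.length_cons]; omega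
  | fail i ks Γ₁ Ω₁ Γ₂ Ω₂ j w _ _ _ ih => simp only [List.length_cons]; omega
  | revive i ks Γ₁ Ω₁ Γ₂ Ω₂ j w hc hnc _ ih =>
    have := numAssigned_update_le Γ₁ j (Γ i)
    simp only [List.length_cons]; omega

lemma Revive.active {Γ : Fin R → Option Cell} {Φ : Fin R → List M} {ks : List (Fin R)}
    {Γ₁ Γ₂ : Fin R → Option Cell} {Ω₁ Ω₂ : Fin R → List M}
    (h : Revive m st I Γ Φ ks Γ₁ Ω₁ Γ₂ Ω₂) (hks : ∀ i ∈ ks, Γ i ≠ none) {a : Fin R}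
    (ha : Γ₁ a ≠ none) : Γ₂ a ≠ none := by
  induction h with
  | nil => exact ha
  | skip i ks Γ₁ Ω₁ Γ₂ Ω₂ _ _ ih => exact ih (fun k hk => hks k (.tail _ hk)) ha
  | fail i ks Γ₁ Ω₁ Γ₂ Ω₂ j w _ _ _ ih => exact ih (fun k hk => hks k (.tail _ hk)) ha
  | revive i ks Γ₁ Ω₁ Γ₂ Ω₂ j w hc hnc _ ih =>
    refine ih (fun k hk => hks k (.tail _ hk)) ?_
    by_cases haj : a = j
    · subst haj
      simpa using hks i (.head _)
    · simpa [haj] using ha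

lemma exists_last_satisfying {α : Type*} (P : α → Prop) (l : List α) (h : ∃ x ∈ l, P x) :
    ∃ pre x suf, l = pre ++ x :: suf ∧ P x ∧ ∀ y ∈ suf, ¬ P y := by
  induction l with
  | nil => simp at h
  | cons a l ih =>
    by_cases h' : ∃ x ∈ l, P x
    · obtain ⟨pre, x, suf, rfl, hx⟩ := ih h'
      exact ⟨a :: pre, x, suf, rfl, hx⟩
    · push Not at h'
      obtain ⟨x, hx, hPx⟩ := h
      rcases List.mem_cons.1 hx with rfl | hx
      · exact ⟨[], x, l, rfl, hPx, h'⟩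
      · exact absurd hPx (h' x hx)

lemma exists_candidate (hm : m.Admissible) {Γ' : Fin R → Option Cell} {i : Fin R} {p : List M}
    (h : ∃ k ∈ I, Γ' k = none ∧ (st k).1 ∈ m.cells (st i) p) :
    ∃ j w, Candidate m st I Γ' i p j w := by
  obtain ⟨k, hk, hΓk, hkp⟩ := h
  obtain ⟨pre, x, suf, hl, ⟨j, hj, hΓj, rfl⟩, hsuf⟩ := exists_last_satisfying
    (fun c => ∃ j ∈ I, Γ' j = none ∧ (st j).1 = c) (m.cells (st i) p) ⟨_, hkp, k, hk, hΓk, rfl⟩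
  have hchain := isChain_cells hm (st i) p
  rw [hl] at hchain
  obtain ⟨w, hw⟩ := exists_path_along hm suf (st j) hchain.right_of_append
  exact ⟨j, w, hj, hΓj, pre, suf, hl, fun a ha hΓa h => hsuf _ h ⟨a, ha, hΓa, rfl⟩, hw⟩

lemma exists_revive (hm : m.Admissible) (Γ : Fin R → Option Cell) (Φ : Fin R → List M)
    (ks : List (Fin R)) (Γ₁ : Fin R → Option Cell) (Ω₁ : Fin R → List M) :
    ∃ Γ₂ Ω₂, Revive m st I Γ Φ ks Γ₁ Ω₁ Γ₂ Ω₂ := by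
  induction ks generalizing Γ₁ Ω₁ with
  | nil => exact ⟨_, _, .nil _ _⟩
  | cons i ks ih =>
    by_cases h : ∃ k ∈ I, Γ₁ k = none ∧ (st k).1 ∈ m.cells (st i) (Φ i)
    · obtain ⟨j, w, hc⟩ := exists_candidate hm h
      by_cases hn : NoConflict m st I (Function.update Γ₁ j (Γ i)) (Function.update Ω₁ j w) j
      · obtain ⟨Γ₂, Ω₂, h⟩ := ih (Function.update Γ₁ j (Γ i)) (Function.update Ω₁ j w)
        exact ⟨Γ₂, Ω₂, .revive _ _ _ _ _ _ _ _ hc hn h⟩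
      · obtain ⟨Γ₂, Ω₂, h⟩ := ih Γ₁ Ω₁
        exact ⟨Γ₂, Ω₂, .fail _ _ _ _ _ _ _ _ hc hn h⟩
    · push Not at h
      obtain ⟨Γ₂, Ω₂, h'⟩ := ih Γ₁ Ω₁
      exact ⟨Γ₂, Ω₂, .skip _ _ _ _ _ _ h h'⟩

lemma exists_feasiblePaths (hm : m.Admissible) (Γ : Fin R → Option Cell) (Φ : Fin R → List M) :
    ∃ Γ' Ω, FeasiblePaths m st I Γ Φ Γ' Ω := by
  classical
  obtain ⟨Γ', Ω, h⟩ := exists_revive (st := st) (I := I) hm Γ Φ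
    (Finset.univ.filter (Killed m st I Γ Φ)).toList
    (fun i => if Killed m st I Γ Φ i then none else Γ i)
    (fun i => if Killed m st I Γ Φ i then [] else Φ i)
  exact ⟨Γ', Ω, (Finset.univ.filter (Killed m st I Γ Φ)).toList, Finset.nodup_toList _, by simp,
    by convert h⟩

lemma FeasiblePaths.isFeasible {Γ Γ' : Fin R → Option Cell} {Φ Ω : Fin R → List M}
    (h : FeasiblePaths m st I Γ Φ Γ' Ω) : IsFeasible m st I Γ' Ω := by
  obtain ⟨ks, -, -, h⟩ := h
  exact h.isFeasible (isFeasible_kill Γ Φ)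

lemma FeasiblePaths.isPlan {Γ Γ' : Fin R → Option Cell} {Φ Ω : Fin R → List M}
    (h : FeasiblePaths m st I Γ Φ Γ' Ω) (hp : IsPlan m st I targets region Γ Φ) :
    IsPlan m st I targets region Γ' Ω := by
  obtain ⟨ks, -, hks, h⟩ := h
  refine h.isPlan hp (fun i hi => ((hks i).1 hi).mem_and_active.2)
    ⟨fun i hi => ?_, fun i γ hi => ?_, fun i γ hi => ?_, fun i γ hi => ?_⟩
  all_goals
    by_cases hk : Killed m st I Γ Φ i
    · first
        | (simp [hk] at hi; done)
        | simp [hk]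
    · simp only [hk, if_false] at hi ⊢
      first
        | exact hp.path_eq_nil i hi
        | exact hp.mem i γ hi
        | exact hp.final i γ hi
        | exact hp.cells i γ hi

lemma FeasiblePaths.numAssigned_le {Γ Γ' : Fin R → Option Cell} {Φ Ω : Fin R → List M}
    (h : FeasiblePaths m st I Γ Φ Γ' Ω) : numAssigned Γ' ≤ numAssigned Γ := by
  classical
  obtain ⟨ks, hnd, hks, h⟩ := h
  refine h.numAssigned_le.trans ?_
  rw [← List.toFinset_card_of_nodup hnd, numAssigned, ← Finset.card_union_of_disjoint]
  · refine Finset.card_le_card fun i hi => ?_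
    rw [Finset.mem_union, List.mem_toFinset, hks, Finset.mem_filter] at hi
    rw [Finset.mem_filter, Option.isSome_iff_ne_none]
    refine ⟨Finset.mem_univ _, ?_⟩
    by_cases hk : Killed m st I Γ Φ i
    · exact hk.mem_and_active.2
    · rcases hi with ⟨-, hi⟩ | hi
      · simpa [hk, Option.isSome_iff_ne_none] using hi
      · exact absurd hi hk
  · rw [Finset.disjoint_left]
    intro i hi hi'
    rw [List.mem_toFinset, hks] at hi'
    simp [hi'] at hi

/-- Goal reassignment never inactivates everybody: if all active participants are killed, then every
participant is unassigned when the first killed path is processed, so the rest of that path, behind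
the last start on it, is free of starts and the participant found gets revived. -/
lemma FeasiblePaths.exists_active (hst : Function.Injective fun i => (st i).1)
    {Γ Γ' : Fin R → Option Cell} {Φ Ω : Fin R → List M} (h : FeasiblePaths m st I Γ Φ Γ' Ω)
    (hΓ : ∃ i, Γ i ≠ none) : ∃ i, Γ' i ≠ none := by
  classical
  obtain ⟨ks, -, hks, h⟩ := h
  have hact : ∀ i ∈ ks, Γ i ≠ none := fun i hi => ((hks i).1 hi).mem_and_active.2
  obtain ⟨i, hi⟩ := hΓ
  by_cases hk : ∃ i, Γ i ≠ none ∧ ¬ Killed m st I Γ Φ i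
  · obtain ⟨a, ha, hka⟩ := hk
    exact ⟨a, h.active hact (by simpa [hka] using ha)⟩
  push Not at hk
  have hnone : (fun i => if Killed m st I Γ Φ i then none else Γ i) = fun _ => none := by
    funext a
    by_cases ha : Γ a = none
    · simp [ha]
    · simp [hk a ha]
  have hempty : ∀ a, (fun i => if Killed m st I Γ Φ i then none else Γ i) a = none :=
    fun a => by rw [hnone]
  cases h with
  | nil => exact absurd ((hks i).2 (hk i hi)) (by simp)
  | skip k ks' _ _ _ _ hs _ =>
    exact absurd (start_mem_cells _ _)
      (hs k ((hks k).1 (.head _)).mem_and_active.1 (hempty k))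
  | revive k ks' _ _ _ _ j w hc _ hr =>
    exact ⟨j, hr.active (fun a ha => hact a (.tail _ ha)) (by simpa using hact k (.head _))⟩
  | fail k ks' _ _ _ _ j w hc hn _ =>
    refine absurd (fun a ha haj => ?_) hn
    have hΓa : Function.update (fun i => if Killed m st I Γ Φ i then none else Γ i) j (Γ k) a
        = none := by
      rw [Function.update_of_ne haj]
      exact hempty a
    obtain ⟨-, -, pre, suf, -, hsuf, hw⟩ := hc
    have hstart : ¬ (st a).1 ∈ m.cells (st j) w := by
      rw [(cells_of_destutter_eq hw).1, List.mem_cons]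
      rintro (h | h)
      · exact haj (hst h)
      · exact hsuf a ha (hempty a) h
    rintro ((⟨-, h, -⟩ | ⟨-, -, h⟩ | ⟨-, h, -⟩) | ⟨-, h, -⟩)
    · exact h hΓa
    · exact hstart (by simpa [StartOn] using h)
    · exact h hΓa
    · exact h hΓa

/-! ### Precedence -/

/-- Only active participants occur in precedences: an inactive one is on no other path. -/
lemma Precedes.active (hst : Function.Injective fun i => (st i).1) {Γ : Fin R → Option Cell}
    {Ω : Fin R → List M} (hp : IsPlan m st I targets region Γ Ω) (hf : IsFeasible m st I Γ Ω)
    {i j : Fin R} (h : Precedes m st I Γ Ω i j) : Γ i ≠ none ∧ Γ j ≠ none := by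
  obtain ⟨hi, hj, hij, h⟩ := h
  have key : StartOn m st Ω i j → Γ i ≠ none ∧ Γ j ≠ none := by
    intro h
    have hΓj : Γ j ≠ none := by
      intro hΓj
      rw [StartOn, hp.path_eq_nil j hΓj, cells_nil, List.mem_singleton] at h
      exact hij (hst h)
    exact ⟨fun hΓi => hf i hi j hj hij (.inl (.inl ⟨hΓi, hΓj, h⟩)), hΓj⟩
  rcases h with h | ⟨γ, hγ, h⟩
  · exact key h
  · refine ⟨fun hΓi => ?_, by simp [hγ]⟩
    rw [hp.path_eq_nil i hΓi, cells_nil, List.mem_singleton] at h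
    refine (key ?_).1 hΓi
    rw [StartOn, ← h, ← hp.final j γ hγ]
    exact final_mem_cells _ _

lemma BreakCycles.eq_or_eq_none {Γ Γ' : Fin R → Option Cell} {Ω : Fin R → List M}
    (h : BreakCycles m st I Γ Ω Γ') (i : Fin R) : Γ' i = Γ i ∨ Γ' i = none := by
  obtain ⟨rank, -, -, h | h⟩ := h
  all_goals
    rw [h i]
    split_ifs
    · exact .inr rfl
    · exact .inl rfl

lemma BreakCycles.ne (hst : Function.Injective fun i => (st i).1) {Γ Γ' : Fin R → Option Cell}
    {Ω : Fin R → List M} (hp : IsPlan m st I targets region Γ Ω) (hf : IsFeasible m st I Γ Ω)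
    (hord : ¬ ∃ ord, IsAbsolutePrecedence m st I Γ Ω ord) (h : BreakCycles m st I Γ Ω Γ') :
    Γ' ≠ Γ := by
  classical
  obtain ⟨rank, hrank, -, h⟩ := h
  -- Without backward edges, sorting by rank would give an absolute precedence.
  have hback : ∃ i j, Precedes m st I Γ Ω i j ∧ rank j < rank i := by
    by_contra hcon
    push Not at hcon
    refine hord ⟨I.toList.insertionSort (fun a b => rank a ≤ rank b), ?_, ?_, ?_⟩
    · exact (List.perm_insertionSort _ _).nodup_iff.2 I.nodup_toList
    · intro i
      rw [(List.perm_insertionSort _ _).mem_iff, Finset.mem_toList]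
    · have : Std.Total fun a b => rank a ≤ rank b := ⟨fun a b => le_total _ _⟩
      have : IsTrans _ fun a b => rank a ≤ rank b := ⟨fun a b c => le_trans⟩
      refine (List.pairwise_insertionSort (fun a b => rank a ≤ rank b) I.toList).imp ?_
      intro a b hab hpre
      exact hpre.2.2.1 (hrank (le_antisymm (hcon b a hpre) hab))
  obtain ⟨i, j, hpre, hlt⟩ := hback
  obtain ⟨hi, hj⟩ := hpre.active hst hp hf
  rintro rfl
  rcases h with h | h
  · refine hi ((h i).trans (if_pos ?_))
    exact Finset.mem_image.2 ⟨(i, j), by simp [hpre, hlt], rfl⟩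
  · refine hj ((h j).trans (if_pos ?_))
    exact Finset.mem_image.2 ⟨(i, j), by simp [hpre, hlt], rfl⟩

/-- Breaking cycles never inactivates everybody: the active participant of least rank is not the
tail, and that of greatest rank not the head, of a backward edge. -/
lemma BreakCycles.exists_active (hst : Function.Injective fun i => (st i).1)
    {Γ Γ' : Fin R → Option Cell} {Ω : Fin R → List M} (hp : IsPlan m st I targets region Γ Ω)
    (hf : IsFeasible m st I Γ Ω) (h : BreakCycles m st I Γ Ω Γ') (hΓ : ∃ i, Γ i ≠ none) :
    ∃ i, Γ' i ≠ none := by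
  obtain ⟨rank, hrank, -, h⟩ := h
  rcases h with h | h
  · obtain ⟨i, hi, hmin⟩ := Set.exists_min_image {i | Γ i ≠ none} rank (Set.toFinite _) hΓ
    refine ⟨i, ?_⟩
    rw [h, if_neg]
    · exact hi
    · intro hmem
      obtain ⟨⟨a, b⟩, he, rfl⟩ := Finset.mem_image.1 hmem
      simp only [Finset.mem_filter, Finset.mem_univ, true_and] at he
      exact absurd (hmin b (he.1.active hst hp hf).2) (not_le.2 he.2)
  · obtain ⟨i, hi, hmax⟩ := Set.exists_max_image {i | Γ i ≠ none} rank (Set.toFinite _) hΓ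
    refine ⟨i, ?_⟩
    rw [h, if_neg]
    · exact hi
    · intro hmem
      obtain ⟨⟨a, b⟩, he, rfl⟩ := Finset.mem_image.1 hmem
      simp only [Finset.mem_filter, Finset.mem_univ, true_and] at he
      exact absurd (hmax a (he.1.active hst hp hf).1) (not_le.2 he.2)

/-- Of an arrangement and its reverse, one has at least half of the edges pointing forward. -/
lemma exists_breakCycles (m : Motion Θ M) (st : Fin R → State Θ) (I : Finset (Fin R))
    (Γ : Fin R → Option Cell) (Ω : Fin R → List M) : ∃ Γ', BreakCycles m st I Γ Ω Γ' := by
  classical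
  let edges := Finset.univ.filter fun e : Fin R × Fin R => Precedes m st I Γ Ω e.1 e.2
  have h : ∃ rank : Fin R → ℕ, Function.Injective rank ∧
      2 * (edges.filter fun e => rank e.2 < rank e.1).card ≤ edges.card := by
    have hdisj : Disjoint (edges.filter fun e => e.2.val < e.1.val)
        (edges.filter fun e => R - e.2.val < R - e.1.val) := by
      rw [Finset.disjoint_filter]
      intro e _ h1 h2
      omega
    have hle := Finset.card_le_card
      (Finset.union_subset (Finset.filter_subset (fun e => e.2.val < e.1.val) edges)
        (Finset.filter_subset (fun e => R - e.2.val < R - e.1.val) edges))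
    rw [Finset.card_union_of_disjoint hdisj] at hle
    by_cases h1 : 2 * (edges.filter fun e => e.2.val < e.1.val).card ≤ edges.card
    · exact ⟨fun i => i.val, Fin.val_injective, h1⟩
    · refine ⟨fun i => R - i.val, fun a b hab => Fin.ext ?_, by dsimp only; omega⟩
      have ha := a.isLt
      have hb := b.isLt
      dsimp only at hab
      omega
  obtain ⟨rank, hrank, hcard⟩ := h
  exact ⟨fun i => if i ∈ (edges.filter fun e => rank e.2 < rank e.1).image Prod.fst
    then none else Γ i, rank, hrank, by convert hcard, .inl fun i => by congr!⟩

/-! ### Time parameterization -/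

lemma offsetStep_cases (m : Motion Θ M) (st : Fin R → State Θ) (Ω : Fin R → List M)
    (Γ : Fin R → Option Cell) (P : Fin R → List M) (H : Finset (Fin R)) (i : Fin R) :
    (Γ i = none ∧
      offsetStep m st Ω (Γ, P, H) i = (Γ, Function.update P i [], insert i H)) ∨
    (Γ i ≠ none ∧ ∃ n : ℕ,
      (∀ k ∈ H, ¬ m.Collide (st i) (List.replicate n m.halt ++ Ω i) (st k) (P k)) ∧
      offsetStep m st Ω (Γ, P, H) i =
        (Γ, Function.update P i (List.replicate n m.halt ++ Ω i), insert i H)) ∨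
    (Γ i ≠ none ∧
      (¬ ∃ n : ℕ, ∀ k ∈ H,
        ¬ m.Collide (st i) (List.replicate n m.halt ++ Ω i) (st k) (P k)) ∧
      offsetStep m st Ω (Γ, P, H) i =
        (Function.update Γ i none, Function.update P i [], insert i H)) := by
  classical
  by_cases h1 : Γ i = none
  · exact .inl ⟨h1, by simp [offsetStep, h1]⟩
  by_cases h2 : ∃ n : ℕ, ∀ k ∈ H,
      ¬ m.Collide (st i) (List.replicate n m.halt ++ Ω i) (st k) (P k)
  · refine .inr (.inl ⟨h1, Nat.find h2, Nat.find_spec h2, ?_⟩)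
    simp only [offsetStep, if_neg h1, dif_pos h2]
  · refine .inr (.inr ⟨h1, h2, ?_⟩)
    simp only [offsetStep, if_neg h1, dif_neg h2]

lemma foldl_offsetStep_eq_or (Ω : Fin R → List M) (ord : List (Fin R)) (Γ : Fin R → Option Cell)
    (P : Fin R → List M) (H : Finset (Fin R)) (i : Fin R) :
    (ord.foldl (offsetStep m st Ω) (Γ, P, H)).1 i = Γ i ∨
      (ord.foldl (offsetStep m st Ω) (Γ, P, H)).1 i = none := by
  induction ord generalizing Γ P H with
  | nil => exact .inl rfl
  | cons a ord ih =>
    rw [List.foldl_cons]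
    rcases offsetStep_cases m st Ω Γ P H a with ⟨-, h⟩ | ⟨-, n, -, h⟩ | ⟨-, -, h⟩
    · rw [h]; exact ih _ _ _
    · rw [h]; exact ih _ _ _
    · rw [h]
      rcases ih (Function.update Γ a none) (Function.update P a []) (insert a H) with h' | h'
      · rw [h']
        by_cases hia : i = a
        · subst hia; exact .inr (by simp)
        · exact .inl (by simp [hia])
      · exact .inr h'

lemma foldl_offsetStep_of_notMem (Ω : Fin R → List M) (ord : List (Fin R))
    (Γ : Fin R → Option Cell) (P : Fin R → List M) (H : Finset (Fin R)) {i : Fin R}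
    (hi : i ∉ ord) : (ord.foldl (offsetStep m st Ω) (Γ, P, H)).1 i = Γ i := by
  induction ord generalizing Γ P H with
  | nil => rfl
  | cons a ord ih =>
    rw [List.mem_cons, not_or] at hi
    rw [List.foldl_cons]
    rcases offsetStep_cases m st Ω Γ P H a with ⟨-, h⟩ | ⟨-, n, -, h⟩ | ⟨-, -, h⟩
    · rw [h]; exact ih _ _ _ hi.2
    · rw [h]; exact ih _ _ _ hi.2
    · rw [h, ih _ _ _ hi.2, Function.update_of_ne hi.1]

lemma timeParam_eq_or (rem : Fin R → List M) (Γ : Fin R → Option Cell) (Ω : Fin R → List M)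
    (ord : List (Fin R)) (i : Fin R) :
    (timeParam m st I rem Γ Ω ord).1 i = Γ i ∨ (timeParam m st I rem Γ Ω ord).1 i = none :=
  foldl_offsetStep_eq_or Ω ord _ _ _ i

/-- As long as only inactive robots, which are on no path, have been treated, the next active one
needs no offset and stays active. -/
lemma foldl_offsetStep_exists_active {Ω : Fin R → List M} {Γ : Fin R → Option Cell}
    (hf : IsFeasible m st Finset.univ Γ Ω) (ord : List (Fin R)) (hord : ord.Nodup)
    (P : Fin R → List M) (H : Finset (Fin R)) (hH : ∀ k ∈ H, Γ k = none ∧ P k = [])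
    (hact : ∃ i ∈ ord, Γ i ≠ none) :
    ∃ i, (ord.foldl (offsetStep m st Ω) (Γ, P, H)).1 i ≠ none := by
  induction ord generalizing P H with
  | nil => simp at hact
  | cons a ord ih =>
    rw [List.nodup_cons] at hord
    rw [List.foldl_cons]
    rcases offsetStep_cases m st Ω Γ P H a with ⟨ha, h⟩ | ⟨ha, n, -, h⟩ | ⟨ha, hn, h⟩
    · rw [h]
      refine ih hord.2 _ _ (fun k hk => ?_) ?_
      · by_cases hka : k = a
        · subst hka; simp [ha]
        · simpa [hka] using hH k ((Finset.mem_insert.1 hk).resolve_left hka)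
      · obtain ⟨i, hi, hΓi⟩ := hact
        rcases List.mem_cons.1 hi with rfl | hi
        · exact absurd ha hΓi
        · exact ⟨i, hi, hΓi⟩
    · refine ⟨a, ?_⟩
      rw [h, foldl_offsetStep_of_notMem _ _ _ _ _ hord.1]
      exact ha
    · refine absurd ⟨0, fun k hk => ?_⟩ hn
      rw [(hH k hk).2]
      refine not_collide_nil fun hmem => ?_
      have hka : k ≠ a := fun hka => ha (hka ▸ (hH k hk).1)
      exact hf k (Finset.mem_univ _) a (Finset.mem_univ _) hka
        (.inl (.inl ⟨(hH k hk).1, ha, hmem⟩))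

lemma timeParam_exists_active {rem : Fin R → List M} {Γ : Fin R → Option Cell}
    {Ω : Fin R → List M} {ord : List (Fin R)} (hI : I = Finset.univ)
    (hf : IsFeasible m st I Γ Ω) (hord : IsAbsolutePrecedence m st I Γ Ω ord)
    (hΓ : ∃ i, Γ i ≠ none) : ∃ i, (timeParam m st I rem Γ Ω ord).1 i ≠ none := by
  subst hI
  obtain ⟨i, hi⟩ := hΓ
  exact foldl_offsetStep_exists_active hf ord hord.1 _ _ (by simp)
    ⟨i, (hord.2.1 i).2 (Finset.mem_univ _), hi⟩

/-- The paths after a time parameterization, started with the paths `P` of the robots in `H`, that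
inactivates nobody. Inactive participants are treated without a check for collisions; the hypothesis
`hinact` makes up for it. -/
lemma foldl_offsetStep_paths (hm : m.Admissible) (hst : Function.Injective fun i => (st i).1)
    {Γ : Fin R → Option Cell} {Ω : Fin R → List M} (hf : IsFeasible m st I Γ Ω)
    (ord : List (Fin R)) (hord : ∀ i ∈ ord, i ∈ I) (P : Fin R → List M) (H : Finset (Fin R))
    (hfree : ∀ i ∈ H, ∀ k ∈ H, i ≠ k → ¬ m.Collide (st i) (P i) (st k) (P k))
    (hinact : ∀ i ∈ I, Γ i = none → ∀ k ∈ H, i ≠ k → ¬ m.Collide (st i) [] (st k) (P k))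
    (hΓ : (ord.foldl (offsetStep m st Ω) (Γ, P, H)).1 = Γ) :
    let P' := (ord.foldl (offsetStep m st Ω) (Γ, P, H)).2.1
    (∀ i, i ∈ H ∨ i ∈ ord → ∀ k, k ∈ H ∨ k ∈ ord → i ≠ k →
      ¬ m.Collide (st i) (P' i) (st k) (P' k)) ∧
    (∀ i ∉ ord, P' i = P i) ∧
    (∀ i ∈ ord, (Γ i = none → P' i = []) ∧
      (Γ i ≠ none → ∃ n, P' i = List.replicate n m.halt ++ Ω i)) := by
  induction ord generalizing P H with
  | nil => simpa using hfree
  | cons a ord ih =>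
    have haI : a ∈ I := hord a (.head _)
    -- It is enough to find a suitable path for the first participant of the order.
    suffices key : ∃ p, offsetStep m st Ω (Γ, P, H) a = (Γ, Function.update P a p, insert a H) ∧
        (Γ a = none → p = []) ∧ (Γ a ≠ none → ∃ n, p = List.replicate n m.halt ++ Ω a) ∧
        ∀ k ∈ H, a ≠ k → ¬ m.Collide (st a) p (st k) (P k) by
      obtain ⟨p, hstep, hp0, hp1, hcol⟩ := key
      rw [List.foldl_cons, hstep] at hΓ ⊢
      have hfree' : ∀ i ∈ insert a H, ∀ k ∈ insert a H, i ≠ k → ¬ m.Collide (st i)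
          (Function.update P a p i) (st k) (Function.update P a p k) := by
        intro i hi k hk hik
        by_cases hia : i = a
        · subst hia
          rw [Function.update_self, Function.update_of_ne hik.symm]
          exact hcol k ((Finset.mem_insert.1 hk).resolve_left hik.symm) hik
        · have hi' := (Finset.mem_insert.1 hi).resolve_left hia
          by_cases hka : k = a
          · subst hka
            rw [Function.update_self, Function.update_of_ne hik, collide_comm]
            exact hcol i hi' hik.symm
          · rw [Function.update_of_ne hia, Function.update_of_ne hka]
            exact hfree i hi' k ((Finset.mem_insert.1 hk).resolve_left hka) hik
      have hinact' : ∀ i ∈ I, Γ i = none → ∀ k ∈ insert a H, i ≠ k →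
          ¬ m.Collide (st i) [] (st k) (Function.update P a p k) := by
        intro i hi hΓi k hk hik
        by_cases hka : k = a
        · subst hka
          rw [Function.update_self, collide_comm]
          refine not_collide_nil fun hmem => ?_
          by_cases hΓk : Γ k = none
          · rw [hp0 hΓk, cells_nil, List.mem_singleton] at hmem
            exact hik (hst hmem)
          · obtain ⟨n, rfl⟩ := hp1 hΓk
            rw [mem_cells_wait_append hm] at hmem
            exact hf i hi k haI hik (.inl (.inl ⟨hΓi, hΓk, hmem⟩))
        · rw [Function.update_of_ne hka]
          exact hinact i hi hΓi k ((Finset.mem_insert.1 hk).resolve_left hka) hik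
      obtain ⟨h1, h2, h3⟩ := ih (fun i hi => hord i (.tail _ hi)) _ _ hfree' hinact' hΓ
      refine ⟨fun i hi k hk => h1 i ?_ k ?_, fun i hi => ?_, fun i hi => ?_⟩
      · simp only [List.mem_cons, Finset.mem_insert] at hi ⊢; tauto
      · simp only [List.mem_cons, Finset.mem_insert] at hk ⊢; tauto
      · rw [List.mem_cons, not_or] at hi
        rw [h2 i hi.2, Function.update_of_ne hi.1]
      · by_cases hio : i ∈ ord
        · exact h3 i hio
        · obtain rfl := (List.mem_cons.1 hi).resolve_right hio
          rw [h2 i hio, Function.update_self]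
          exact ⟨hp0, hp1⟩
    rcases offsetStep_cases m st Ω Γ P H a with ⟨ha, h⟩ | ⟨ha, n, hn, h⟩ | ⟨ha, -, h⟩
    · exact ⟨_, h, fun _ => rfl, fun h => absurd ha h, fun k hk hak => hinact a haI ha k hk hak⟩
    · exact ⟨_, h, fun h => absurd h ha, fun _ => ⟨n, rfl⟩, fun k hk _ => hn k hk⟩
    · -- The assignment of a participant, once cancelled, is not restored.
      rw [List.foldl_cons, h] at hΓ
      have := foldl_offsetStep_eq_or (m := m) (st := st) Ω ord (Function.update Γ a none)
        (Function.update P a []) (insert a H) a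
      rw [hΓ, Function.update_self, or_self] at this
      exact absurd this ha

lemma timeParam_paths (hm : m.Admissible) (hst : Function.Injective fun i => (st i).1)
    {rem : Fin R → List M} (hI : ∀ i ∈ I, rem i = [])
    (hrem : ∀ i k, i ≠ k → ¬ m.Collide (st i) (rem i) (st k) (rem k))
    {Γ : Fin R → Option Cell} {Ω : Fin R → List M} (hf : IsFeasible m st I Γ Ω)
    {ord : List (Fin R)} (hord : IsAbsolutePrecedence m st I Γ Ω ord)
    (hΓ : (timeParam m st I rem Γ Ω ord).1 = Γ) :
    let P := (timeParam m st I rem Γ Ω ord).2.1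
    (∀ i k, i ≠ k → ¬ m.Collide (st i) (P i) (st k) (P k)) ∧
    (∀ i ∉ I, P i = rem i) ∧
    (∀ i ∈ I, (Γ i = none → P i = []) ∧
      (Γ i ≠ none → ∃ n, P i = List.replicate n m.halt ++ Ω i)) := by
  obtain ⟨h1, h2, h3⟩ := foldl_offsetStep_paths hm hst hf ord (fun i => (hord.2.1 i).1) rem
    (Finset.univ \ I) (fun i _ k _ => hrem i k)
    (fun i hi _ k _ hik => by simpa [hI i hi] using hrem i k hik) hΓ
  have hmem : ∀ i, i ∈ Finset.univ \ I ∨ i ∈ ord := fun i => by simp [hord.2.1, em']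
  exact ⟨fun i k => h1 i (hmem i) k (hmem k), fun i hi => h2 i (by rwa [hord.2.1]),
    fun i hi => h3 i (by rwa [hord.2.1])⟩

end Planning

/-! ### Views -/

section Views

variable {X Y : ℕ} {free : Finset Cell}

/-- What holds of the local view of a robot that has visited the cells `A`, when `B` are the cells
visited by all robots. Other robots are taken for obstacles, so an obstacle-free cell may be marked
as an obstacle, but only if it has been visited. -/
structure LocalSound (free : Finset Cell) (A B : Set Cell) (V : View) : Prop where
  mem_cov : ∀ p, p ∈ V.cov ↔ p ∈ A
  goal_free : ∀ q ∈ V.goal, q ∈ free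
  goal_near : ∀ q ∈ V.goal, ∃ p ∈ A, q ∈ nbrs p
  obs_visited : ∀ q ∈ V.obs, q ∈ free → q ∈ B
  closed : ∀ p ∈ A, ∀ q ∈ nbrs p, q ∈ free → q ∈ V.cov ∪ V.goal ∪ V.obs

lemma LocalSound.mono {A B B' : Set Cell} {V : View} (h : LocalSound free A B V) (hB : B ⊆ B') :
    LocalSound free A B' V :=
  ⟨h.mem_cov, h.goal_free, h.goal_near, fun q hq hf => hB (h.obs_visited q hq hf), h.closed⟩

lemma localSound_empty (B : Set Cell) : LocalSound free ∅ B View.empty := by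
  constructor <;> simp [View.empty]

lemma LocalSound.observe (hfree : free ⊆ grid X Y) {A B : Set Cell} {V : View}
    (h : LocalSound free A B V) {occ : Finset Cell} (hocc : ∀ q ∈ occ, q ∈ B) (p : Cell) :
    LocalSound free (insert p A) B (V.observe X Y free occ p) := by
  refine ⟨fun c => ?_, fun q hq => ?_, fun q hq => ?_, fun q hq hf => ?_, fun a ha q hq hf => ?_⟩
  · simp [View.observe, h.mem_cov]
  · simp only [View.observe, Finset.mem_sdiff, Finset.mem_union, Finset.mem_inter] at hq
    rcases hq.1 with h1 | h1
    · exact h.goal_free q h1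
    · exact h1.2.1
  · simp only [View.observe, Finset.mem_sdiff, Finset.mem_union, Finset.mem_inter] at hq
    rcases hq.1 with h1 | h1
    · obtain ⟨a, ha, hqa⟩ := h.goal_near q h1
      exact ⟨a, .inr ha, hqa⟩
    · exact ⟨p, .inl rfl, h1.1.1⟩
  · simp only [View.observe, Finset.mem_sdiff, Finset.mem_union, Finset.mem_inter] at hq
    rcases hq.1 with h1 | h1
    · exact h.obs_visited q h1 hf
    · exact hocc q (by tauto)
  · have hg := hfree hf
    have key : q ∈ V.cov ∪ V.goal ∪ V.obs ∨ q ∈ nbrs p := by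
      rcases ha with rfl | ha
      · exact .inr hq
      · exact .inl (h.closed a ha q hq hf)
    simp only [View.observe, View.unexplored, Finset.mem_sdiff, Finset.mem_union,
      Finset.mem_inter, Finset.mem_insert] at key ⊢
    grind

lemma LocalSound.foldl_observe (hfree : free ⊆ grid X Y) {A B : Set Cell} {V : View}
    (h : LocalSound free A B V) (occ : ℕ → Finset Cell) (p : ℕ → Cell) (l : ℕ)
    (hocc : ∀ t < l, ∀ q ∈ occ t, q ∈ B) :
    LocalSound free (A ∪ {c | ∃ t < l, p t = c}) B
      ((List.range l).foldl (fun V t => V.observe X Y free (occ t) (p t)) V) := by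
  induction l with
  | zero => simpa using h
  | succ l ih =>
    rw [List.range_succ, List.foldl_append, List.foldl_cons, List.foldl_nil]
    convert (ih fun t ht => hocc t (ht.trans l.lt_succ_self)).observe hfree
      (hocc l l.lt_succ_self) (p l) using 1
    ext c
    simp only [Set.mem_union, Set.mem_ofPred_eq, Set.mem_insert_iff, Nat.lt_succ_iff_lt_or_eq]
    constructor
    · rintro (h | ⟨t, ht | rfl, rfl⟩)
      · exact .inr (.inl h)
      · exact .inr (.inr ⟨t, ht, rfl⟩)
      · exact .inl rfl
    · rintro (rfl | h | ⟨t, ht, rfl⟩)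
      · exact .inr ⟨l, .inr rfl, rfl⟩
      · exact .inl h
      · exact .inr ⟨t, .inl ht, rfl⟩

/-- What holds of the global view when the robots `i` have visited the cells `A i`, in total the
cells `B`, and the requests of all robots except those in `pending` have been received. -/
structure GlobalSound {R : ℕ} (free : Finset Cell) (pending : Finset (Fin R)) (A : Fin R → Set Cell)
    (B : Set Cell) (V : View) : Prop where
  cov_visited : ∀ p ∈ V.cov, p ∈ B
  goal_free : ∀ q ∈ V.goal, q ∈ free
  goal_notMem_cov : ∀ q ∈ V.goal, q ∉ V.cov
  goal_near : ∀ q ∈ V.goal, ∃ i, ∃ p ∈ A i, q ∈ nbrs p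
  obs_visited : ∀ q ∈ V.obs, q ∈ free → q ∈ B
  obs_notMem_cov : ∀ q ∈ V.obs, q ∉ V.cov
  received_cov : ∀ i ∉ pending, ∀ p ∈ A i, p ∈ V.cov
  closed : ∀ i ∉ pending, ∀ p ∈ A i, ∀ q ∈ nbrs p, q ∈ free → q ∈ V.cov ∪ V.goal ∪ V.obs

lemma globalSound_empty {R : ℕ} (A : Fin R → Set Cell) (B : Set Cell) :
    GlobalSound free Finset.univ A B View.empty := by
  constructor <;> simp [View.empty]

lemma GlobalSound.merge {R : ℕ} (hfree : free ⊆ grid X Y) {pending : Finset (Fin R)}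
    {A : Fin R → Set Cell} {B : Set Cell} {V L : View} (h : GlobalSound free pending A B V)
    (i : Fin R) (hA : A i ⊆ B) (hL : LocalSound free (A i) B L) :
    GlobalSound free (pending.erase i) A B (V.merge X Y L) := by
  refine ⟨fun p hp => ?_, fun q hq => ?_, fun q hq => ?_, fun q hq => ?_, fun q hq hf => ?_,
    fun q hq => ?_, fun k hk p hp => ?_, fun k hk p hp q hq hf => ?_⟩
  · rcases Finset.mem_union.1 hp with hp | hp
    · exact h.cov_visited p hp
    · exact hA ((hL.mem_cov p).1 hp)
  · simp only [View.merge, Finset.mem_sdiff, Finset.mem_union, Finset.mem_inter] at hq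
    rcases hq.1 with h1 | h1
    · exact h.goal_free q h1
    · exact hL.goal_free q h1.1
  · exact (Finset.mem_sdiff.1 hq).2
  · simp only [View.merge, Finset.mem_sdiff, Finset.mem_union, Finset.mem_inter] at hq
    rcases hq.1 with h1 | h1
    · exact h.goal_near q h1
    · exact ⟨i, hL.goal_near q h1.1⟩
  · simp only [View.merge, Finset.mem_sdiff, Finset.mem_union, Finset.mem_inter] at hq
    rcases hq.1 with h1 | h1
    · exact h.obs_visited q h1 hf
    · exact hL.obs_visited q h1.1 hf
  · exact (Finset.mem_sdiff.1 hq).2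
  · by_cases hki : k = i
    · subst hki
      exact Finset.mem_union_right _ ((hL.mem_cov p).2 hp)
    · exact Finset.mem_union_left _ (h.received_cov k (by simpa [hki] using hk) p hp)
  · have hg := hfree hf
    have key : q ∈ V.cov ∪ V.goal ∪ V.obs ∨ q ∈ L.cov ∪ L.goal ∪ L.obs := by
      by_cases hki : k = i
      · subst hki
        exact .inr (hL.closed p hp q hq hf)
      · exact .inl (h.closed k (by simpa [hki] using hk) p hp q hq hf)
    simp only [View.merge, View.unexplored, Finset.mem_sdiff, Finset.mem_union,
      Finset.mem_inter] at key ⊢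
    grind

/-- When all requests have been received, an obstacle-free neighbour of a visited cell is covered or
a goal. -/
lemma GlobalSound.mem_region {R : ℕ} {A : Fin R → Set Cell} {B : Set Cell} {V : View}
    (h : GlobalSound free ∅ A B V) (hB : ∀ p ∈ B, ∃ i, p ∈ A i) {i : Fin R} {p q : Cell}
    (hp : p ∈ A i) (hq : q ∈ nbrs p) (hf : q ∈ free) : q ∈ V.goal ∪ V.cov := by
  have h1 := h.closed i (by simp) p hp q hq hf
  by_cases h2 : q ∈ V.obs
  · obtain ⟨k, hk⟩ := hB q (h.obs_visited q h2 hf)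
    exact absurd (h.received_cov k (by simp) q hk) (h.obs_notMem_cov q h2)
  · simp only [Finset.mem_union] at h1 ⊢
    tauto

end Views

lemma mem_cells_take_iff {Θ M : Type*} {m : Motion Θ M} {s : State Θ} {p : List M} {l : ℕ}
    {c : Cell} : c ∈ m.cells s (p.take l) ↔ ∃ t ≤ l, m.pos s p t = c := by
  have key : ∀ t ≤ l, m.pos s (p.take l) t = m.pos s p t := by
    intro t ht
    simp [Motion.pos, List.take_take, ht]
  constructor
  · intro h
    obtain ⟨t, ht, rfl⟩ := mem_cells_iff.1 h
    have ht' : t ≤ l := ht.trans (List.length_take_le _ _)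
    exact ⟨t, ht', (key t ht').symm⟩
  · rintro ⟨t, ht, rfl⟩
    rw [← key t ht]
    exact pos_mem_cells _ _ _

/-! ### The invariant of the runs -/

section System

variable {R : ℕ} {Θ M : Type*} {m : Motion Θ M} {X Y : ℕ} {free : Finset Cell}
  {s₀ : Fin R → State Θ}

/-- The cells that robot `i` has visited. -/
def Config.visitedBy (c : Config R Θ M) (i : Fin R) : Set Cell := {p | ∃ s ∈ c.full i, s.1 = p}

/-- The cells that the robots have visited. -/
def Config.visited (c : Config R Θ M) : Set Cell := {p | ∃ i, ∃ s ∈ c.full i, s.1 = p}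

/-- The part of the invariant that does not depend on the phase of the planner. -/
structure Sound (m : Motion Θ M) (free : Finset Cell) (s₀ : Fin R → State Θ)
    (c : Config R Θ M) : Prop where
  path : ∃ (q : Fin R → List M) (l : ℕ), ∀ i, (q i).length = l ∧
    c.full i = m.states (s₀ i) (q i) ∧ c.state i = m.final (s₀ i) (q i)
  visited_free : ∀ p ∈ c.visited, p ∈ free
  lview : ∀ i, LocalSound free (c.visitedBy i) c.visited (c.lview i)
  gview : GlobalSound free c.pending c.visitedBy c.visited c.gview
  rem_free : ∀ i, ∀ p ∈ m.cells (c.state i) (c.rem i), p ∈ free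
  rem_collide : ∀ i k, i ≠ k → ¬ m.Collide (c.state i) (c.rem i) (c.state k) (c.rem k)
  mem_reserved : ∀ p, p ∈ c.reserved ↔
    ∃ i, c.rem i ≠ [] ∧ (m.final (c.state i) (c.rem i)).1 = p
  par_rem : ∀ i ∈ c.par, c.rem i = []
  inact_rem : ∀ i ∈ c.inact, c.rem i = []

/-- All requests have been received, and the participants are the robots without remaining path. -/
def Config.Ready (c : Config R Θ M) : Prop := c.pending = ∅ ∧ ∀ i, c.rem i = [] → i ∈ c.par

/-- The part of the invariant that belongs to a phase. In the planning loop, somebody is assigned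
when all robots are participants, and once paths are determined some robot is active, so the planner
does not get stuck. -/
def PhaseSound (m : Motion Θ M) (free : Finset Cell) (c : Config R Θ M) : Phase R M → Prop
  | .collect => c.nReq + c.pending.card = c.nAct ∧ c.pending.Nonempty ∧
      ∀ i, c.rem i = [] → i ∈ c.par ∨ i ∈ c.pending ∨ i ∈ c.inact
  | .horizon => c.Ready
  | .resolve Γ Φ => c.Ready ∧
      IsPlan m c.state c.par c.unassigned (c.gview.goal ∪ c.gview.cov) Γ Φ ∧
      (c.par = Finset.univ → ∃ i, Γ i ≠ none)
  | .dispatch P => c.Ready ∧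
      (∀ i k, i ≠ k → ¬ m.Collide (c.state i) (combine c P i) (c.state k) (combine c P k)) ∧
      (∀ i, ∀ p ∈ m.cells (c.state i) (combine c P i), p ∈ free) ∧
      (activeRobots c P).Nonempty ∧
      ∀ i ∈ c.par, P i ≠ [] → (m.final (c.state i) (P i)).1 ∈ c.unassigned
  | .exited => c.Ready ∧ c.par = Finset.univ ∧ c.unassigned = ∅

/-- The invariant of the runs. -/
def Invariant (m : Motion Θ M) (free : Finset Cell) (s₀ : Fin R → State Θ)
    (c : Config R Θ M) : Prop :=
  Sound m free s₀ c ∧ PhaseSound m free c c.phase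

lemma visitedBy_subset_visited (c : Config R Θ M) (i : Fin R) : c.visitedBy i ⊆ c.visited :=
  fun _ hp => ⟨i, hp⟩

lemma Sound.with_phase {c : Config R Θ M} (h : Sound m free s₀ c) (φ : Phase R M) :
    Sound m free s₀ { c with phase := φ } where
  path := h.path
  visited_free := h.visited_free
  lview := h.lview
  gview := h.gview
  rem_free := h.rem_free
  rem_collide := h.rem_collide
  mem_reserved := h.mem_reserved
  par_rem := h.par_rem
  inact_rem := h.inact_rem

lemma Sound.state_mem {c : Config R Θ M} (h : Sound m free s₀ c) (i : Fin R) :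
    (c.state i).1 ∈ c.visitedBy i := by
  obtain ⟨q, l, hq⟩ := h.path
  have := final_mem_cells (m := m) (s₀ i) (q i)
  rw [← (hq i).2.2] at this
  obtain ⟨s, hs, hs'⟩ := List.mem_map.1 this
  exact ⟨s, (hq i).2.1 ▸ hs, hs'⟩

lemma Sound.injective {c : Config R Θ M} (h : Sound m free s₀ c) :
    Function.Injective fun i => (c.state i).1 := by
  intro i k hik
  by_contra hne
  refine h.rem_collide i k hne ⟨0, .inl ?_⟩
  rw [pos_zero, pos_zero]
  exact hik

lemma Sound.mem_cov_iff {c : Config R Θ M} (h : Sound m free s₀ c) (hc : c.Ready) {p : Cell} :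
    p ∈ c.gview.cov ↔ p ∈ c.visited := by
  refine ⟨h.gview.cov_visited p, fun ⟨i, hp⟩ => h.gview.received_cov i ?_ p hp⟩
  rw [hc.1]
  exact Finset.notMem_empty i

lemma Sound.region_free {c : Config R Θ M} (h : Sound m free s₀ c) {p : Cell}
    (hp : p ∈ c.gview.goal ∪ c.gview.cov) : p ∈ free := by
  rcases Finset.mem_union.1 hp with hp | hp
  · exact h.gview.goal_free p hp
  · exact h.visited_free p (h.gview.cov_visited p hp)

/-- A goal is next to a cell that some robot has visited, and that robot can go back there. -/
lemma Sound.exists_isRoute (hm : m.Admissible) {c : Config R Θ M} (h : Sound m free s₀ c)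
    (hc : c.Ready) {γ : Cell} (hγ : γ ∈ c.gview.goal) :
    ∃ i p, m.IsRoute (c.gview.goal ∪ c.gview.cov) (c.state i) γ p := by
  obtain ⟨i, p, hp, hγp⟩ := h.gview.goal_near γ hγ
  obtain ⟨q, l, hq⟩ := h.path
  obtain ⟨-, hfull, hstate⟩ := hq i
  have hmem : ∀ x ∈ m.cells (s₀ i) (q i), x ∈ c.gview.goal ∪ c.gview.cov := by
    intro x hx
    obtain ⟨s, hs, rfl⟩ := List.mem_map.1 hx
    exact Finset.mem_union_right _ ((h.mem_cov_iff hc).2 ⟨i, s, hfull ▸ hs, rfl⟩)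
  have hpc : p ∈ m.cells (s₀ i) (q i) := by
    obtain ⟨s, hs, rfl⟩ := hp
    exact List.mem_map_of_mem (hfull ▸ hs)
  have hreach := (final_reaches_cells hm (s₀ i) (q i) (↑(c.gview.goal ∪ c.gview.cov))
    hmem hpc).tail ⟨hγp, Finset.mem_coe.2 (Finset.mem_union_left _ hγ)⟩
  rw [← hstate] at hreach
  have hs : (c.state i).1 ∈ c.gview.goal ∪ c.gview.cov := by
    rw [hstate]
    exact hmem _ (final_mem_cells _ _)
  obtain ⟨w, hw, hfin⟩ := exists_path_of_reaches hm (c.state i) hs hreach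
  exact ⟨i, OnDemCPP.exists_isRoute hw hfin⟩

lemma invariant_initial (hfree : free ⊆ grid X Y) (hR : 0 < R) (hs₀ : ∀ i, (s₀ i).1 ∈ free)
    (hinj : Function.Injective fun i => (s₀ i).1) :
    Invariant m free s₀ (initial X Y free s₀ : Config R Θ M) := by
  have hby : ∀ i, (initial X Y free s₀ : Config R Θ M).visitedBy i = {(s₀ i).1} := by
    intro i
    ext p
    simp [Config.visitedBy, initial, eq_comm]
  have hvis : ∀ i, (s₀ i).1 ∈ (initial X Y free s₀ : Config R Θ M).visited :=
    fun i => ⟨i, s₀ i, by simp [initial], rfl⟩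
  refine ⟨⟨⟨fun _ => [], 0, fun i => ⟨rfl, (states_nil _).symm, rfl⟩⟩, ?_, fun i => ?_,
    globalSound_empty _ _, fun i p hp => ?_, fun i k hik => ?_, ?_, ?_, ?_⟩, ?_, ?_, ?_⟩
  · rintro p ⟨i, s, hs, rfl⟩
    obtain rfl := List.mem_singleton.1 hs
    exact hs₀ i
  · have := (localSound_empty (free := free)
      (initial X Y free s₀ : Config R Θ M).visited).observe hfree
      (occ := (Finset.univ.erase i).image fun k => (s₀ k).1) (fun q hq => by
        obtain ⟨k, -, rfl⟩ := Finset.mem_image.1 hq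
        exact hvis k) (s₀ i).1
    rw [hby]
    rw [insert_empty_eq] at this
    exact this
  · rw [show (initial X Y free s₀ : Config R Θ M).rem i = [] from rfl, cells_nil,
      List.mem_singleton] at hp
    rw [hp]
    exact hs₀ i
  · refine not_collide_nil fun h => ?_
    rw [show (initial X Y free s₀ : Config R Θ M).rem i = [] from rfl, cells_nil,
      List.mem_singleton] at h
    exact hik (hinj h).symm
  · simp [initial]
  · simp [initial]
  · simp [initial]
  · simp [initial]
  · exact ⟨⟨0, hR⟩, Finset.mem_univ _⟩
  · exact fun i _ => .inr (.inl (Finset.mem_univ i))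

lemma invariant_receive (hfree : free ⊆ grid X Y) {c : Config R Θ M} {i : Fin R}
    (h : Sound m free s₀ c) (hp : PhaseSound m free c .collect) (hi : i ∈ c.pending)
    (hphase : c.phase = .collect) : Invariant m free s₀ (receive X Y c i) := by
  obtain ⟨hcard, hne, hrem⟩ := hp
  have hg := h.gview.merge hfree i (visitedBy_subset_visited c i) (h.lview i)
  have hpar : ∀ k ∈ (if c.rem i = [] then insert i c.par else c.par), c.rem k = [] := by
    intro k hk
    split_ifs at hk with hri
    · rcases Finset.mem_insert.1 hk with rfl | hk
      · exact hri
      · exact h.par_rem k hk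
    · exact h.par_rem k hk
  have hpar' : ∀ k, c.rem k = [] → k ∈ (if c.rem i = [] then insert i c.par else c.par) ∨
      k ∈ c.pending.erase i ∨ k ∈ c.inact := by
    intro k hk
    by_cases hki : k = i
    · subst hki
      exact .inl (by simp [hk])
    · rcases hrem k hk with h | h | h
      · left
        split_ifs
        · exact Finset.mem_insert_of_mem h
        · exact h
      · exact .inr (.inl (Finset.mem_erase.2 ⟨hki, h⟩))
      · exact .inr (.inr h)
  have hcard' := Finset.card_erase_of_mem hi
  have hpos := Finset.card_pos.2 hne
  unfold receive
  dsimp only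
  split_ifs with hreq hr hr
  all_goals simp only [hr, if_true, if_false] at hpar hpar'
  any_goals
    have hempty : c.pending.erase i = ∅ := by
      rw [← Finset.card_eq_zero]; omega
    refine ⟨⟨h.path, h.visited_free, h.lview, hg, h.rem_free, h.rem_collide, h.mem_reserved,
      fun k hk => (Finset.mem_union.1 hk).elim (hpar k) (h.inact_rem k), h.inact_rem⟩,
      hempty, fun k hk => ?_⟩
    rcases hpar' k hk with h | h | h
    · exact Finset.mem_union_left _ h
    · rw [hempty] at h
      exact absurd h (Finset.notMem_empty k)
    · exact Finset.mem_union_right _ h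
  all_goals
    refine ⟨⟨h.path, h.visited_free, h.lview, hg, h.rem_free, h.rem_collide, h.mem_reserved,
      hpar, h.inact_rem⟩, ?_⟩
    dsimp only
    rw [hphase]
    refine ⟨?_, Finset.card_pos.1 ?_, hpar'⟩
    · change c.nReq + 1 + (c.pending.erase i).card = c.nAct
      omega
    · change 0 < (c.pending.erase i).card
      omega

lemma phaseSound_assign (hm : m.Admissible) {c : Config R Θ M} (h : Sound m free s₀ c)
    (hc : c.Ready) (hne : c.unassigned ≠ ∅) {Γ : Fin R → Option Cell} {Φ : Fin R → List M}
    (hopt : OptimalPaths m c.state c.par c.unassigned (c.gview.goal ∪ c.gview.cov) Γ Φ) :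
    PhaseSound m free c (.resolve Γ Φ) := by
  refine ⟨hc, hopt.isPlan, fun hpar => ?_⟩
  obtain ⟨γ, hγ⟩ := Finset.nonempty_iff_ne_empty.2 hne
  obtain ⟨i, hi⟩ := h.exists_isRoute hm hc (Finset.mem_sdiff.1 hγ).1
  exact hopt.exists_active (hpar ▸ Finset.mem_univ i) hγ hi

lemma exists_active_of_par_ne {c : Config R Θ M} (hc : c.Ready) (hpar : c.par ≠ Finset.univ)
    (P : Fin R → List M) : (activeRobots c P).Nonempty := by
  obtain ⟨i, hi⟩ := not_forall.1 fun h => hpar (Finset.eq_univ_iff_forall.2 h)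
  refine ⟨i, Finset.mem_filter.2 ⟨Finset.mem_univ i, ?_⟩⟩
  rw [combine, if_neg hi]
  exact List.length_pos_iff.2 fun h => hi (hc.2 i h)

lemma phaseSound_skip {c : Config R Θ M} (h : Sound m free s₀ c) (hc : c.Ready)
    (hpar : c.par ≠ Finset.univ) : PhaseSound m free c (.dispatch fun _ => []) := by
  have hcomb : combine c (fun _ => []) = c.rem := by
    funext i
    by_cases hi : i ∈ c.par
    · rw [combine, if_pos hi, h.par_rem i hi]
    · rw [combine, if_neg hi]
  refine ⟨hc, ?_, ?_, exists_active_of_par_ne hc hpar _, fun i _ hne => absurd rfl hne⟩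
  · rw [hcomb]; exact h.rem_collide
  · rw [hcomb]; exact h.rem_free

lemma phaseSound_accept (hm : m.Admissible) {c : Config R Θ M} (h : Sound m free s₀ c)
    {Γ Γ' : Fin R → Option Cell} {Φ Ω : Fin R → List M} {ord : List (Fin R)}
    (hp : PhaseSound m free c (.resolve Γ Φ)) (hfp : FeasiblePaths m c.state c.par Γ Φ Γ' Ω)
    (hord : IsAbsolutePrecedence m c.state c.par Γ' Ω ord)
    (hΓ : (timeParam m c.state c.par c.rem Γ' Ω ord).1 = Γ') :
    PhaseSound m free c (.dispatch (timeParam m c.state c.par c.rem Γ' Ω ord).2.1) := by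
  obtain ⟨hc, hplan, hact⟩ := hp
  have hplan' := hfp.isPlan hplan
  obtain ⟨h1, h2, h3⟩ := timeParam_paths hm h.injective h.par_rem h.rem_collide hfp.isFeasible
    hord hΓ
  set P := (timeParam m c.state c.par c.rem Γ' Ω ord).2.1 with hP
  have hcomb : combine c P = P := by
    funext i
    by_cases hi : i ∈ c.par
    · rw [combine, if_pos hi]
    · rw [combine, if_neg hi, h2 i hi]
  have hsome : ∀ i γ, Γ' i = some γ → (m.final (c.state i) (P i)).1 = γ ∧
      ∀ p ∈ m.cells (c.state i) (P i), p ∈ free := by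
    intro i γ hi
    obtain ⟨n, hn⟩ := (h3 i (hplan'.mem i γ hi).1).2 (by simp [hi])
    rw [hn, final_wait_append hm]
    refine ⟨hplan'.final i γ hi, fun p hp => ?_⟩
    rw [mem_cells_wait_append hm] at hp
    exact h.region_free (hplan'.cells i γ hi p hp)
  refine ⟨hc, by rwa [hcomb], fun i p hp => ?_, ?_, fun i hi hne => ?_⟩
  · rw [hcomb] at hp
    by_cases hi : i ∈ c.par
    · cases hΓi : Γ' i with
      | none =>
        rw [(h3 i hi).1 hΓi, ← h.par_rem i hi] at hp
        exact h.rem_free i p hp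
      | some γ => exact (hsome i γ hΓi).2 p hp
    · rw [h2 i hi] at hp
      exact h.rem_free i p hp
  · by_cases hpar : c.par = Finset.univ
    · obtain ⟨i, hi⟩ := hfp.exists_active h.injective (hact hpar)
      obtain ⟨γ, hγ⟩ := Option.ne_none_iff_exists'.1 hi
      refine ⟨i, Finset.mem_filter.2 ⟨Finset.mem_univ i, ?_⟩⟩
      rw [hcomb]
      -- The goal of an assigned robot is not covered, so it differs from its start.
      refine List.length_pos_iff.2 fun hnil => ?_
      have hfin := (hsome i γ hγ).1
      rw [hnil, final_nil] at hfin
      have hgoal := (Finset.mem_sdiff.1 (hplan'.mem i γ hγ).2).1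
      exact h.gview.goal_notMem_cov γ hgoal
        ((h.mem_cov_iff hc).2 (visitedBy_subset_visited c i (hfin ▸ h.state_mem i)))
    · exact exists_active_of_par_ne hc hpar _
  · cases hΓi : Γ' i with
    | none => exact absurd ((h3 i hi).1 hΓi) hne
    | some γ =>
      rw [(hsome i γ hΓi).1]
      exact (hplan'.mem i γ hΓi).2

lemma phaseSound_reject {c : Config R Θ M} (h : Sound m free s₀ c)
    {Γ Γ' : Fin R → Option Cell} {Φ Ω : Fin R → List M} {ord : List (Fin R)}
    (hp : PhaseSound m free c (.resolve Γ Φ)) (hfp : FeasiblePaths m c.state c.par Γ Φ Γ' Ω)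
    (hord : IsAbsolutePrecedence m c.state c.par Γ' Ω ord) :
    PhaseSound m free c (.resolve (timeParam m c.state c.par c.rem Γ' Ω ord).1
      (adjustPaths (timeParam m c.state c.par c.rem Γ' Ω ord).1 Ω)) :=
  ⟨hp.1, (hfp.isPlan hp.2.1).adjustPaths (timeParam_eq_or _ _ _ _), fun hpar =>
    timeParam_exists_active hpar hfp.isFeasible hord
      (hfp.exists_active h.injective (hp.2.2 hpar))⟩

lemma phaseSound_breakCycles {c : Config R Θ M} (h : Sound m free s₀ c)
    {Γ Γ' Γ'' : Fin R → Option Cell} {Φ Ω : Fin R → List M}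
    (hp : PhaseSound m free c (.resolve Γ Φ)) (hfp : FeasiblePaths m c.state c.par Γ Φ Γ' Ω)
    (hb : BreakCycles m c.state c.par Γ' Ω Γ'') :
    PhaseSound m free c (.resolve Γ'' (adjustPaths Γ'' Ω)) :=
  ⟨hp.1, (hfp.isPlan hp.2.1).adjustPaths hb.eq_or_eq_none, fun hpar =>
    hb.exists_active h.injective (hfp.isPlan hp.2.1) hfp.isFeasible
      (hfp.exists_active h.injective (hp.2.2 hpar))⟩

end System

/-! ### The execution of a horizon -/

section Execution

variable {R : ℕ} {Θ M : Type*} {m : Motion Θ M} {X Y : ℕ} {free : Finset Cell}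
  {s₀ : Fin R → State Θ} {c : Config R Θ M} {P : Fin R → List M} {l : ℕ}

lemma combine_eq_nil_of_notMem {i : Fin R} (hi : i ∉ activeRobots c P) : combine c P i = [] := by
  by_contra h
  exact hi (Finset.mem_filter.2 ⟨Finset.mem_univ i, List.length_pos_iff.2 h⟩)

lemma Sound.exists_path_execute (hm : m.Admissible) (h : Sound m free s₀ c)
    (hl : ∀ i ∈ activeRobots c P, l ≤ (combine c P i).length) :
    ∃ (q : Fin R → List M) (n : ℕ), ∀ i, (q i).length = n ∧
      (execute m X Y free c P l).full i = m.states (s₀ i) (q i) ∧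
      (execute m X Y free c P l).state i = m.final (s₀ i) (q i) := by
  obtain ⟨q, n, hq⟩ := h.path
  refine ⟨fun i => q i ++ if i ∈ activeRobots c P then (combine c P i).take l
    else List.replicate l m.halt, n + l, fun i => ?_⟩
  obtain ⟨h1, h2, h3⟩ := hq i
  have hfull : (execute m X Y free c P l).full i = c.full i ++
    (if i ∈ activeRobots c P then (m.states (c.state i) ((combine c P i).take l)).tail
      else List.replicate l (c.state i)) := rfl
  have hstate : (execute m X Y free c P l).state i =
    m.final (c.state i) ((combine c P i).take l) := rfl
  rw [hfull, hstate, h2, states_append, final_append, ← h3, List.length_append, h1]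
  by_cases hi : i ∈ activeRobots c P
  · simp [hi, hl i hi]
  · simp [hi, combine_eq_nil_of_notMem hi, states_replicate_halt hm, final_replicate_halt hm,
      final_nil, List.replicate_succ]

lemma Sound.mem_visitedBy_execute (h : Sound m free s₀ c) (i : Fin R) (p : Cell) :
    p ∈ (execute m X Y free c P l).visitedBy i ↔
      p ∈ c.visitedBy i ∨ ∃ t < l, m.pos (c.state i) (combine c P i) (t + 1) = p := by
  have hfull : (execute m X Y free c P l).full i = c.full i ++
    (if i ∈ activeRobots c P then (m.states (c.state i) ((combine c P i).take l)).tail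
      else List.replicate l (c.state i)) := rfl
  -- Whether or not the start of a path is counted makes no difference: it has been visited before.
  have hstart : p ∈ c.visitedBy i ∨ (∃ t < l, m.pos (c.state i) (combine c P i) (t + 1) = p) ↔
      p ∈ c.visitedBy i ∨ p ∈ m.cells (c.state i) ((combine c P i).take l) := by
    rw [mem_cells_take_iff]
    constructor
    · rintro (hp | ⟨t, ht, hp⟩)
      · exact .inl hp
      · exact .inr ⟨t + 1, ht, hp⟩
    · rintro (hp | ⟨t, ht, rfl⟩)
      · exact .inl hp
      · rcases t with _ | t
        · rw [pos_zero]
          exact .inl (h.state_mem i)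
        · exact .inr ⟨t, ht, rfl⟩
  rw [hstart]
  simp only [Config.visitedBy, Set.mem_ofPred_eq, hfull, List.mem_append, or_and_right, exists_or]
  by_cases hi : i ∈ activeRobots c P
  · obtain ⟨L, hL⟩ := states_eq_cons (m := m) (c.state i) ((combine c P i).take l)
    rw [if_pos hi]
    simp only [Motion.cells, List.mem_map, hL, List.tail_cons, List.mem_cons, or_and_right,
      exists_or, exists_eq_left]
    have := h.state_mem i
    constructor
    · exact Or.imp_right .inr
    · rintro (h | rfl | h)
      · exact .inl h
      · exact .inl this
      · exact .inr h
  · rw [if_neg hi, combine_eq_nil_of_notMem hi, List.take_nil, cells_nil]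
    have := h.state_mem i
    constructor
    · rintro (h | ⟨s, hs, rfl⟩)
      · exact .inl h
      · obtain rfl := (List.mem_replicate.1 hs).2
        exact .inl this
    · rintro (h | h)
      · exact .inl h
      · rw [List.mem_singleton] at h
        subst h
        exact .inl this

lemma Sound.visitedBy_subset_execute (h : Sound m free s₀ c) (i : Fin R) :
    c.visitedBy i ⊆ (execute m X Y free c P l).visitedBy i :=
  fun p hp => (h.mem_visitedBy_execute i p).2 (.inl hp)

lemma Sound.visited_subset_execute (h : Sound m free s₀ c) :
    c.visited ⊆ (execute m X Y free c P l).visited :=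
  fun _ ⟨i, hp⟩ => ⟨i, h.visitedBy_subset_execute i hp⟩

lemma Sound.visitedBy_execute_of_notMem (h : Sound m free s₀ c) {i : Fin R}
    (hi : i ∉ activeRobots c P) : (execute m X Y free c P l).visitedBy i = c.visitedBy i := by
  ext p
  rw [h.mem_visitedBy_execute, combine_eq_nil_of_notMem hi]
  refine ⟨?_, .inl⟩
  rintro (hp | ⟨t, -, rfl⟩)
  · exact hp
  · rw [pos_nil]
    exact h.state_mem i

lemma Sound.lview_execute (hfree : free ⊆ grid X Y) (h : Sound m free s₀ c) (i : Fin R) :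
    LocalSound free ((execute m X Y free c P l).visitedBy i) (execute m X Y free c P l).visited
      ((execute m X Y free c P l).lview i) := by
  have hold := (h.lview i).mono (h.visited_subset_execute (P := P) (l := l) (X := X) (Y := Y))
  have hlview : (execute m X Y free c P l).lview i = if i ∈ activeRobots c P then
      (List.range l).foldl (fun V t => V.observe X Y free
        ((Finset.univ.erase i).image fun k => m.pos (c.state k) (combine c P k) (t + 1))
        (m.pos (c.state i) (combine c P i) (t + 1))) (c.lview i) else c.lview i := rfl
  rw [hlview]
  split_ifs with hi
  · convert hold.foldl_observe hfree
      (fun t => (Finset.univ.erase i).image fun k => m.pos (c.state k) (combine c P k) (t + 1))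
      (fun t => m.pos (c.state i) (combine c P i) (t + 1)) l ?_ using 1
    · ext p
      rw [h.mem_visitedBy_execute]
      rfl
    · intro t ht q hq
      obtain ⟨k, -, rfl⟩ := Finset.mem_image.1 hq
      exact ⟨k, (h.mem_visitedBy_execute k _).2 (.inr ⟨t, ht, rfl⟩)⟩
  · rw [h.visitedBy_execute_of_notMem hi]
    exact hold

lemma Sound.gview_execute (h : Sound m free s₀ c) (hc : c.Ready) :
    GlobalSound free (activeRobots c P) (execute m X Y free c P l).visitedBy
      (execute m X Y free c P l).visited c.gview := by
  have hg := h.gview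
  rw [hc.1] at hg
  have hsub := h.visited_subset_execute (P := P) (l := l) (X := X) (Y := Y)
  refine ⟨fun p hp => hsub (hg.cov_visited p hp), hg.goal_free, hg.goal_notMem_cov,
    fun q hq => ?_, fun q hq hf => hsub (hg.obs_visited q hq hf), hg.obs_notMem_cov,
    fun i hi p hp => ?_, fun i hi p hp => ?_⟩
  · obtain ⟨i, p, hp, hqp⟩ := hg.goal_near q hq
    exact ⟨i, p, h.visitedBy_subset_execute i hp, hqp⟩
  · rw [h.visitedBy_execute_of_notMem hi] at hp
    exact hg.received_cov i (Finset.notMem_empty i) p hp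
  · rw [h.visitedBy_execute_of_notMem hi] at hp
    exact hg.closed i (Finset.notMem_empty i) p hp

lemma invariant_execute (hm : m.Admissible) (hfree : free ⊆ grid X Y) (h : Sound m free s₀ c)
    (hp : PhaseSound m free c (.dispatch P))
    (hl : ∀ i ∈ activeRobots c P, l ≤ (combine c P i).length) :
    Invariant m free s₀ (execute m X Y free c P l) := by
  obtain ⟨hc, hcol, hcells, hact, hgoal⟩ := hp
  refine ⟨⟨h.exists_path_execute hm hl, ?_, h.lview_execute hfree, h.gview_execute hc,
    fun i p hp => hcells i p (mem_cells_drop hp), fun i k hik => not_collide_drop (hcol i k hik) l,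
    fun p => ?_, fun i hi => absurd hi (Finset.notMem_empty i), fun i hi => ?_⟩, ?_, hact,
    fun i hi => ?_⟩
  · rintro p ⟨i, hp⟩
    rcases (h.mem_visitedBy_execute i p).1 hp with hp | ⟨t, -, rfl⟩
    · exact h.visited_free p (visitedBy_subset_visited c i hp)
    · exact hcells i _ (pos_mem_cells _ _ _)
  · simp only [execute, Finset.mem_image, Finset.mem_filter, Finset.mem_univ, true_and,
      List.length_pos_iff, ← final_append, List.take_append_drop]
  · simp [execute, combine_eq_nil_of_notMem (Finset.mem_sdiff.1 hi).2]
  · exact Nat.zero_add _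
  · by_cases hi' : i ∈ activeRobots c P
    · exact .inr (.inl hi')
    · exact .inr (.inr (Finset.mem_sdiff.2 ⟨Finset.mem_univ i, hi'⟩))

end Execution

/-! ### Runs -/

section Runs

variable {R : ℕ} {Θ M : Type*} {m : Motion Θ M} {X Y : ℕ} {free : Finset Cell}
  {s₀ : Fin R → State Θ}

lemma Invariant.step (hm : m.Admissible) (hfree : free ⊆ grid X Y) {c c' : Config R Θ M}
    (h : Invariant m free s₀ c) (hstep : Step m X Y free c c') : Invariant m free s₀ c' := by
  obtain ⟨hs, hp⟩ := h
  cases hstep with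
  | receive i hphase hi =>
    rw [hphase] at hp
    exact invariant_receive hfree hs hp hi hphase
  | assign Γ Φ hphase hne hopt =>
    rw [hphase] at hp
    exact ⟨hs.with_phase _, phaseSound_assign hm hs hp hne hopt⟩
  | skip hphase _ hpar =>
    rw [hphase] at hp
    exact ⟨hs.with_phase _, phaseSound_skip (c := c) hs hp hpar⟩
  | exit hphase hne hpar =>
    rw [hphase] at hp
    exact ⟨hs.with_phase _, hp, hpar, hne⟩
  | accept Γ Φ Γ' Ω ord hphase hfp hord hΓ =>
    rw [hphase] at hp
    exact ⟨hs.with_phase _, phaseSound_accept hm hs hp hfp hord hΓ⟩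
  | reject Γ Φ Γ' Ω ord Γ'' hphase hfp hord hΓ hne =>
    rw [hphase] at hp
    subst hΓ
    exact ⟨hs.with_phase _, phaseSound_reject hs hp hfp hord⟩
  | breakCycles Γ Φ Γ' Ω Γ'' hphase hfp hord hb =>
    rw [hphase] at hp
    exact ⟨hs.with_phase _, phaseSound_breakCycles hs hp hfp hb⟩
  | execute P l hphase hl =>
    rw [hphase] at hp
    exact invariant_execute hm hfree hs hp fun i hi => hl.2 ⟨i, hi, rfl⟩

lemma Invariant.of_reachable (hm : m.Admissible) (hfree : free ⊆ grid X Y) (hR : 0 < R)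
    (hs₀ : ∀ i, (s₀ i).1 ∈ free) (hinj : Function.Injective fun i => (s₀ i).1)
    {c : Config R Θ M} (h : Reachable m X Y free s₀ c) : Invariant m free s₀ c := by
  induction h with
  | refl => exact invariant_initial hfree hR hs₀ hinj
  | tail _ hstep ih => exact ih.step hm hfree hstep

open Classical in
/-- The obstacle-free cells that have neither been visited nor are reserved. -/
noncomputable def openCells (free : Finset Cell) (c : Config R Θ M) : Finset Cell :=
  free.filter fun p => p ∉ c.visited ∧ p ∉ c.reserved

/-- A bound for the number of steps until the execution of the current horizon. -/
def phaseMeasure (c : Config R Θ M) : Phase R M → ℕ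
  | .collect => R + 4 + c.pending.card
  | .horizon => R + 3
  | .resolve Γ _ => numAssigned Γ + 2
  | .dispatch _ => 1
  | .exited => 0

/-- The quantity that decreases in every step. A horizon in which a participant gets active makes
its goal reserved or visited; any other one shortens the remaining paths. -/
noncomputable def runMeasure (free : Finset Cell) (c : Config R Θ M) : ℕ ×ₗ ℕ ×ₗ ℕ :=
  toLex ((openCells free c).card,
    toLex (∑ i, (c.rem i).length, phaseMeasure c c.phase))

lemma runMeasure_lt {c c' : Config R Θ M} (hv : c'.visited = c.visited)
    (hr : c'.reserved = c.reserved) (hrem : c'.rem = c.rem)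
    (hp : phaseMeasure c' c'.phase < phaseMeasure c c.phase) :
    runMeasure free c' < runMeasure free c := by
  rw [runMeasure, runMeasure, openCells, openCells, hv, hr, hrem, Prod.Lex.toLex_lt_toLex]
  exact .inr ⟨rfl, Prod.Lex.toLex_lt_toLex.2 (.inr ⟨rfl, hp⟩)⟩

lemma runMeasure_execute {c : Config R Θ M} (h : Sound m free s₀ c) {P : Fin R → List M} {l : ℕ}
    (hp : PhaseSound m free c (.dispatch P))
    (hl : IsLeast {n | ∃ i ∈ activeRobots c P, n = (combine c P i).length} l) :
    runMeasure free (execute m X Y free c P l) < runMeasure free c := by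
  classical
  obtain ⟨hc, -, hcells, hact, hgoal⟩ := hp
  have hpos : 0 < l := by
    obtain ⟨i, hi, rfl⟩ := hl.1
    exact (Finset.mem_filter.1 hi).2
  -- The end of a non-empty path is reached in this horizon or reserved for the next one.
  have hend : ∀ i, combine c P i ≠ [] → (m.final (c.state i) (combine c P i)).1 ∉
      openCells free (execute m X Y free c P l) := by
    intro i hi hmem
    obtain ⟨-, h1, h2⟩ := Finset.mem_filter.1 hmem
    by_cases hlen : (combine c P i).length ≤ l
    · refine h1 ⟨i, (h.mem_visitedBy_execute i _).2 (.inr ⟨l - 1, by omega, ?_⟩)⟩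
      rw [Nat.sub_add_cancel hpos, pos_of_length_le hlen]
    · refine h2 (Finset.mem_image.2 ⟨i, Finset.mem_filter.2 ⟨Finset.mem_univ i, ?_⟩, rfl⟩)
      rw [List.length_drop]
      omega
  have hsub : openCells free (execute m X Y free c P l) ⊆ openCells free c := by
    intro p hp
    obtain ⟨h1, h2, h3⟩ := Finset.mem_filter.1 hp
    refine Finset.mem_filter.2 ⟨h1, fun hv => h2 (h.visited_subset_execute hv), fun hr => ?_⟩
    obtain ⟨i, hi, rfl⟩ := (h.mem_reserved p).1 hr
    have hcomb : combine c P i = c.rem i := by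
      rw [combine, if_neg fun hpar => hi (h.par_rem i hpar)]
    rw [← hcomb] at hi hp
    exact hend i hi hp
  by_cases hpar : ∃ i ∈ c.par, P i ≠ []
  · obtain ⟨i, hi, hne⟩ := hpar
    have hcomb : combine c P i = P i := by rw [combine, if_pos hi]
    obtain ⟨hg, hres⟩ := Finset.mem_sdiff.1 (hgoal i hi hne)
    have hmem : (m.final (c.state i) (P i)).1 ∈ openCells free c :=
      Finset.mem_filter.2 ⟨h.gview.goal_free _ hg,
        fun hv => h.gview.goal_notMem_cov _ hg ((h.mem_cov_iff hc).2 hv), hres⟩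
    refine Prod.Lex.toLex_lt_toLex.2 (.inl (Finset.card_lt_card
      ((Finset.ssubset_iff_of_subset hsub).2 ⟨_, hmem, ?_⟩)))
    have := hend i
    rw [hcomb] at this
    exact this hne
  · push Not at hpar
    have hcomb : ∀ i, combine c P i = c.rem i := by
      intro i
      by_cases hi : i ∈ c.par
      · rw [combine, if_pos hi, hpar i hi, h.par_rem i hi]
      · rw [combine, if_neg hi]
    have hsum : ∑ i, ((execute m X Y free c P l).rem i).length < ∑ i, (c.rem i).length := by
      obtain ⟨i, hi⟩ := hact
      have hlen : ∀ i, ((execute m X Y free c P l).rem i).length = (c.rem i).length - l := by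
        intro i
        rw [← hcomb]
        exact List.length_drop
      have hi := (Finset.mem_filter.1 hi).2
      rw [hcomb] at hi
      refine Finset.sum_lt_sum (fun k _ => by rw [hlen]; omega) ⟨i, Finset.mem_univ i, ?_⟩
      rw [hlen]
      omega
    rcases (Finset.card_le_card hsub).lt_or_eq with hlt | heq
    · exact Prod.Lex.toLex_lt_toLex.2 (.inl hlt)
    · exact Prod.Lex.toLex_lt_toLex.2
        (.inr ⟨heq, Prod.Lex.toLex_lt_toLex.2 (.inl hsum)⟩)

lemma numAssigned_le (Γ : Fin R → Option Cell) : numAssigned Γ ≤ R :=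
  (Finset.card_le_univ _).trans_eq (Fintype.card_fin R)

lemma runMeasure_step {c c' : Config R Θ M} (h : Invariant m free s₀ c)
    (hstep : Step m X Y free c c') : runMeasure free c' < runMeasure free c := by
  obtain ⟨hs, hp⟩ := h
  cases hstep with
  | receive i hphase hi =>
    have hcard := Finset.card_erase_of_mem hi
    have hpos := Finset.card_pos.2 ⟨i, hi⟩
    rw [hphase] at hp
    unfold receive
    dsimp only
    split_ifs
    all_goals
      refine runMeasure_lt rfl rfl rfl ?_
      rw [hphase]
      simp only [phaseMeasure]
      omega
  | assign Γ Φ hphase hne hopt =>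
    refine runMeasure_lt rfl rfl rfl ?_
    have := numAssigned_le Γ
    simp only [phaseMeasure, hphase]
    omega
  | skip hphase _ hpar =>
    refine runMeasure_lt rfl rfl rfl ?_
    simp only [phaseMeasure, hphase]
    omega
  | exit hphase hne hpar =>
    refine runMeasure_lt rfl rfl rfl ?_
    simp only [phaseMeasure, hphase]
    omega
  | accept Γ Φ Γ' Ω ord hphase hfp hord hΓ =>
    refine runMeasure_lt rfl rfl rfl ?_
    simp only [phaseMeasure, hphase]
    omega
  | reject Γ Φ Γ' Ω ord Γ'' hphase hfp hord hΓ hne =>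
    refine runMeasure_lt rfl rfl rfl ?_
    subst hΓ
    have h1 := hfp.numAssigned_le
    have h2 := numAssigned_lt (timeParam_eq_or c.rem Γ' Ω ord) hne
    simp only [phaseMeasure, hphase]
    omega
  | breakCycles Γ Φ Γ' Ω Γ'' hphase hfp hord hb =>
    refine runMeasure_lt rfl rfl rfl ?_
    rw [hphase] at hp
    have h1 := hfp.numAssigned_le
    have h2 := numAssigned_lt hb.eq_or_eq_none
      (hb.ne hs.injective (hfp.isPlan hp.2.1) hfp.isFeasible hord)
    simp only [phaseMeasure, hphase]
    omega
  | execute P l hphase hl =>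
    rw [hphase] at hp
    exact runMeasure_execute hs hp hl

lemma Invariant.exists_step [Finite Θ] [Finite M] (hm : m.Admissible) {c : Config R Θ M}
    (h : Invariant m free s₀ c) (hexit : c.phase ≠ .exited) : ∃ c', Step m X Y free c c' := by
  obtain ⟨hs, hp⟩ := h
  cases hphase : c.phase with
  | collect =>
    rw [hphase] at hp
    obtain ⟨i, hi⟩ := hp.2.1
    exact ⟨_, .receive c i hphase hi⟩
  | horizon =>
    by_cases hne : c.unassigned = ∅
    · by_cases hpar : c.par = Finset.univ
      · exact ⟨_, .exit c hphase hne hpar⟩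
      · exact ⟨_, .skip c hphase hne hpar⟩
    · obtain ⟨Γ, Φ, hopt⟩ := exists_optimalPaths m c.state c.par c.unassigned
        (c.gview.goal ∪ c.gview.cov)
      exact ⟨_, .assign c Γ Φ hphase hne hopt⟩
  | resolve Γ Φ =>
    obtain ⟨Γ', Ω, hfp⟩ := exists_feasiblePaths (st := c.state) (I := c.par) hm Γ Φ
    by_cases hord : ∃ ord, IsAbsolutePrecedence m c.state c.par Γ' Ω ord
    · obtain ⟨ord, hord⟩ := hord
      by_cases hΓ : (timeParam m c.state c.par c.rem Γ' Ω ord).1 = Γ'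
      · exact ⟨_, .accept c Γ Φ Γ' Ω ord hphase hfp hord hΓ⟩
      · exact ⟨_, .reject c Γ Φ Γ' Ω ord _ hphase hfp hord rfl hΓ⟩
    · obtain ⟨Γ'', hb⟩ := exists_breakCycles m c.state c.par Γ' Ω
      exact ⟨_, .breakCycles c Γ Φ Γ' Ω Γ'' hphase hfp hord hb⟩
  | dispatch P =>
    rw [hphase] at hp
    obtain ⟨i, hi⟩ := hp.2.2.2.1
    have hne : {n | ∃ i ∈ activeRobots c P, n = (combine c P i).length}.Nonempty :=
      ⟨_, i, hi, rfl⟩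
    exact ⟨_, .execute c P _ hphase ⟨Nat.sInf_mem hne, fun n hn => Nat.sInf_le hn⟩⟩
  | exited => exact absurd hphase hexit

/-- On exit no goals are left, so with a cell all its obstacle-free neighbours have been visited. -/
lemma Invariant.visited_eq (hconn : StronglyConnected free) (hR : 0 < R) {c : Config R Θ M}
    (h : Invariant m free s₀ c) (hexit : c.phase = .exited) : c.visited = free := by
  obtain ⟨hs, hp⟩ := h
  rw [hexit] at hp
  obtain ⟨hc, hpar, hun⟩ := hp
  have hgoal : c.gview.goal = ∅ := by
    have hres : c.reserved = ∅ := by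
      refine Finset.eq_empty_of_forall_notMem fun p hp => ?_
      obtain ⟨i, hi, -⟩ := (hs.mem_reserved p).1 hp
      exact hi (hs.par_rem i (hpar ▸ Finset.mem_univ i))
    rwa [Config.unassigned, hres, Finset.sdiff_empty] at hun
  refine Set.Subset.antisymm (fun p hp => hs.visited_free p hp) fun p hp => ?_
  have hstart := visitedBy_subset_visited c _ (hs.state_mem ⟨0, hR⟩)
  have hreach := hconn _ (hs.visited_free _ hstart) p hp
  clear hp
  induction hreach with
  | refl => exact hstart
  | tail _ hbc ih =>
    obtain ⟨i, hi⟩ := ih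
    have hg := hs.gview
    rw [hc.1] at hg
    have hmem := hg.mem_region (fun _ hp => hp) hi hbc.1 hbc.2
    rw [hgoal, Finset.empty_union] at hmem
    exact hg.cov_visited _ hmem

end Runs

end OnDemCPP

theorem mainTheorem1 {R : ℕ} {Θ M : Type*} [Finite Θ] [Finite M]
    (m : OnDemCPP.Motion Θ M) (hm : m.Admissible)
    (X Y : ℕ) (free : Finset OnDemCPP.Cell) (hfree : free ⊆ OnDemCPP.grid X Y)
    (hconn : OnDemCPP.StronglyConnected free)
    (hR : 0 < R) (s₀ : Fin R → OnDemCPP.State Θ) (hs₀ : ∀ i, (s₀ i).1 ∈ free)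
    (hinj : Function.Injective fun i => (s₀ i).1) :
    -- there is no infinite run,
    (¬ ∃ run : ℕ → OnDemCPP.Config R Θ M, run 0 = OnDemCPP.initial X Y free s₀ ∧
      ∀ n, OnDemCPP.Step m X Y free (run n) (run (n + 1))) ∧
    -- a run that cannot be continued has reached the exit of the planner,
    (∀ c, OnDemCPP.Reachable m X Y free s₀ c → (∀ c', ¬ OnDemCPP.Step m X Y free c c') →
      c.phase = OnDemCPP.Phase.exited) ∧
    -- and on exit the full paths have equal length and visit exactly the obstacle-free cells.
    (∀ c, OnDemCPP.Reachable m X Y free s₀ c → c.phase = OnDemCPP.Phase.exited →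
      ∃ l : ℕ, (∀ i, (c.full i).length = l + 1) ∧
        {p | ∃ i, ∃ s ∈ c.full i, s.1 = p} = (free : Set OnDemCPP.Cell)) := by
  have hinv : ∀ {c}, OnDemCPP.Reachable m X Y free s₀ c → OnDemCPP.Invariant m free s₀ c :=
    fun h => .of_reachable hm hfree hR hs₀ hinj h
  refine ⟨?_, fun c hc hstuck => ?_, fun c hc hexit => ?_⟩
  · rintro ⟨run, h0, hrun⟩
    have hreach : ∀ n, OnDemCPP.Reachable m X Y free s₀ (run n) := by
      intro n
      induction n with
      | zero => rw [h0]; exact .refl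
      | succ n ih => exact .tail ih (hrun n)
    exact not_strictAnti_of_wellFoundedLT (fun n => OnDemCPP.runMeasure free (run n))
      (strictAnti_nat_of_succ_lt fun n => OnDemCPP.runMeasure_step (hinv (hreach n)) (hrun n))
  · by_contra hexit
    obtain ⟨c', hc'⟩ := (hinv hc).exists_step (X := X) (Y := Y) hm hexit
    exact hstuck c' hc'
  · obtain ⟨q, l, hq⟩ := (hinv hc).1.path
    refine ⟨l, fun i => ?_, (hinv hc).visited_eq hconn hR hexit⟩
    rw [(hq i).2.1, OnDemCPP.states_length, (hq i).1]
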